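/- All structures are finite. A $3$-hypergraph $H$ has a finite vertex set $V(H)$ and an edge set $E(H)\subseteq\binom{V(H)}{3}$; write $v(H)=|V(H)|$, let $H[W]$ be the subhypergraph on $W\subseteq V(H)$ whose edges are the edges of $H$ contained in $W$, and put $H-W=H[V(H)\setminus W]$. A set $M\subseteq V(H)$ is a module of $H$ if for each $e\in E(H)$ with $e\cap M\neq\emptyset$ and $e\setminus M\neq\emptyset$ there is $m\in M$ such that $e\cap M=\{m\}$ and $(e\setminus\{m\})\cup\{n\}\in E(H)$ for every $n\in M$. The modules $\emptyset$, $V(H)$ and $\{v\}$ ($v\in V(H)$) are trivial. $H$ is indecomposable if all its modules are trivial, decomposable otherwise; it is prime if it is indecomposable and $v(H)\geq 3$; it is critical if it is prime and $H-\{v\}$ is decomposable for each $v\in V(H)$. The primality graph $\mathscr{P}(H)$ is the graph on $V(H)$ in which distinct $v,w$ are adjacent if and only if $H-\{v,w\}$ is prime. For a tournament $T$, $C_3(T)$ is the $3$-hypergraph on $V(T)$ whose edges are the sets that induce a $3$-cycle in $T$. For odd $m$, $T_m$ (respectively $U_m$) is the tournament on $\{0,\dots,m-1\}$ obtained from the usual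 linear order (with an arc from $i$ to $j$ for $i<j$) by reversing all arcs between even and odd vertices (respectively between even vertices). $H$ is circular if $v(H)$ is odd and $H$ is isomorphic to $C_3(T_{v(H)})$. For a graph $\Gamma$ let $\mathfrak{C}(\Gamma)$ be the set of its components; $v(C)$ is the number of vertices of $C\in\mathfrak C(\Gamma)$, $C$ is called even or odd according to the parity of $v(C)$, and nontrivial if $v(C)\neq 1$. Put $w(C)=\lfloor v(C)/2\rfloor$. Consider the conditions: (1) all the components of $\Gamma$ are paths; (2) $\Gamma$ has a nontrivial component; for each odd component $C$ with $V(\Gamma)\setminus V(C)\neq\emptyset$ there is a nontrivial component other than $C$; for each even component $C$ with $|V(\Gamma)\setminus V(C)|\geq 2$ there is a nontrivial component other than $C$. Let $\mathbb H$ be a $\{2,3\}$-hypergraph on $\mathfrak C(\Gamma)$, that is, each edge of $\mathbb H$ is a set of $2$ or $3$ components. The parity conditions are: (3) each edge of $\mathbb H$ of size $2$ contains an even component and an odd component, and each edge of $\mathbb H$ of size $3$ consists of odd components. Given such $\Gamma$ and $\mathbb H$, and for each $C\in\mathfrak C(\Gamma)$ an isomorphism $\varphi_C$ from the path $P_{v(C)}$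 on $\{0,\dots,v(C)-1\}$ onto $C$, the $3$-hypergraph $\Gamma\bullet\mathbb H$ on $V(\Gamma)$ has as edges exactly: the edges of $\varphi_C(C_3(U_{v(C)}))$ for each odd nontrivial component $C$; the sets $\{\varphi_C(2i),\varphi_C(2j+1),\varphi_D(2k)\}$ with $0\leq i\leq j\leq w(C)-1$ and $0\leq k\leq w(D)$, for each edge $\{C,D\}$ of $\mathbb H$ with $C$ even and $D$ odd; the sets $\{\varphi_I(2i),\varphi_J(2j),\varphi_K(2k)\}$ with $0\leq i\leq w(I)$, $0\leq j\leq w(J)$ and $0\leq k\leq w(K)$, for each edge $\{I,J,K\}$ of $\mathbb H$ of size $3$. **Theorem.** Let $H$ be a critical $3$-hypergraph with $v(H)\geq 5$. If $H$ is not circular, then there exist a graph $\Gamma$ on $V(H)$ satisfying (1) and (2), and a $\{2,3\}$-hypergraph $\mathbb H$ on $\mathfrak C(\Gamma)$ satisfying (3), such that $H=\Gamma\bullet\mathbb H$, for every choice of the isomorphisms $\varphi_C$. Moreover, $\Gamma$ can be taken to be the primality graph $\mathscr P(H)$. -/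

import Mathlib

/-! ### Hypergraphs: uniformity, induced subhypergraphs, modules, criticality -/

namespace Hypergraph

/-- `H` is a `k`-hypergraph: each edge is a set of `k` vertices (intended for `k ≥ 1`). -/
def IsUniform {α : Type*} (H : Hypergraph α) (k : ℕ) : Prop :=
  ∀ e ∈ H.edgeSet, e.ncard = k

/-- `H` is a `{2,3}`-hypergraph: each edge is a set of `2` or `3` vertices. -/
def IsTwoThree {α : Type*} (H : Hypergraph α) : Prop :=
  ∀ e ∈ H.edgeSet, e.ncard = 2 ∨ e.ncard = 3

/-- The subhypergraph `H[W]` of `H` induced by `W` (for `W ⊆ V(H)`). -/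
def induce {α : Type*} (H : Hypergraph α) (W : Set α) : Hypergraph α where
  vertexSet := H.vertexSet ∩ W
  edgeSet := {e | e ∈ H.edgeSet ∧ e ⊆ W}
  subset_vertexSet_of_mem_edgeSet' := fun _ he =>
    Set.subset_inter (H.subset_vertexSet_of_mem_edgeSet' he.1) he.2

/-- The subhypergraph `H - W = H[V(H) \ W]`. -/
def delete {α : Type*} (H : Hypergraph α) (W : Set α) : Hypergraph α :=
  H.induce (H.vertexSet \ W)

/-- `M` is a module of `H`. -/
def IsModule {α : Type*} (H : Hypergraph α) (M : Set α) : Prop :=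
  M ⊆ H.vertexSet ∧
    ∀ e ∈ H.edgeSet, (e ∩ M).Nonempty → (e \ M).Nonempty →
      ∃ m ∈ M, e ∩ M = {m} ∧ ∀ n ∈ M, (e \ {m}) ∪ {n} ∈ H.edgeSet

/-- The trivial modules are `∅`, `V(H)` and the singletons `{v}` with `v ∈ V(H)`. -/
def IsTrivialModule {α : Type*} (H : Hypergraph α) (M : Set α) : Prop :=
  M = ∅ ∨ M = H.vertexSet ∨ ∃ v ∈ H.vertexSet, M = {v}

/-- `H` is indecomposable if all its modules are trivial. -/
def Indecomposable {α : Type*} (H : Hypergraph α) : Prop :=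
  ∀ M : Set α, H.IsModule M → H.IsTrivialModule M

/-- `H` is prime if it is indecomposable and has at least three vertices. -/
def IsPrime {α : Type*} (H : Hypergraph α) : Prop :=
  H.Indecomposable ∧ 3 ≤ H.vertexSet.ncard

/-- A prime hypergraph `H` is critical if `H - v` is decomposable for each vertex `v`. -/
def IsCritical {α : Type*} (H : Hypergraph α) : Prop :=
  H.IsPrime ∧ ∀ v ∈ H.vertexSet, ¬ (H.delete {v}).Indecomposable

/-- The primality graph of `H`, defined on `V(H)`: distinct `v` and `w` are adjacent
if and only if `H - {v, w}` is prime. -/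
def primalityGraph {α : Type*} (H : Hypergraph α) : SimpleGraph H.vertexSet where
  Adj v w := v ≠ w ∧ (H.delete {(v : α), (w : α)}).IsPrime
  symm := ⟨fun v w h => ⟨h.1.symm, by rw [Set.pair_comm]; exact h.2⟩⟩
  loopless := ⟨fun _ h => h.1 rfl⟩

/-- `H` and `K` are isomorphic: some bijection from `V(H)` onto `V(K)` maps the edges of `H`
exactly onto the edges of `K`. -/
def IsIsomorphic {α β : Type*} (H : Hypergraph α) (K : Hypergraph β) : Prop :=
  ∃ f : H.vertexSet ≃ K.vertexSet, ∀ e : Set H.vertexSet,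
    (Subtype.val '' e ∈ H.edgeSet ↔ Subtype.val '' (f '' e) ∈ K.edgeSet)

end Hypergraph

/-! ### Tournaments and their `C₃`-structures -/

/-- The `3`-cycle, the tournament on `{0, 1, 2}` with the arcs `01`, `12`, `20`. -/
def threeCycle : Digraph (Fin 3) where
  Adj i j := (i = 0 ∧ j = 1) ∨ (i = 1 ∧ j = 2) ∨ (i = 2 ∧ j = 0)

/-- The `C₃`-structure of a tournament `T`: the `3`-hypergraph on the vertices of `T` whose edges
are the sets `X` such that `T[X]` is isomorphic to the `3`-cycle. -/
def Digraph.cThree {V : Type*} (T : Digraph V) : Hypergraph V where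
  vertexSet := Set.univ
  edgeSet := {X | ∃ f : Fin 3 ≃ X, ∀ i j,
    threeCycle.Adj i j ↔ T.Adj (f i : V) (f j : V)}
  subset_vertexSet_of_mem_edgeSet' := fun _ _ => Set.subset_univ _

/-- The tournament `T_m` on `{0, …, m - 1}` (used for odd `m`): the usual linear order
`0 → 1 → ⋯ → m - 1` in which all arcs between even and odd vertices are reversed. -/
def tournamentT (m : ℕ) : Digraph (Fin m) where
  Adj i j := (i < j ∧ (Even i.val ↔ Even j.val)) ∨ (j < i ∧ ¬ (Even i.val ↔ Even j.val))

/-- The tournament `U_m` on `{0, …, m - 1}` (used for odd `m`): the usual linear order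
`0 → 1 → ⋯ → m - 1` in which all arcs between even vertices are reversed. -/
def tournamentU (m : ℕ) : Digraph (Fin m) where
  Adj i j := (i < j ∧ ¬ (Even i.val ∧ Even j.val)) ∨ (j < i ∧ (Even i.val ∧ Even j.val))

/-- `H` is circular: `v(H)` is odd and `H` is isomorphic to `C₃(T_{v(H)})`. -/
def Hypergraph.IsCircular {α : Type*} (H : Hypergraph α) : Prop :=
  Odd H.vertexSet.ncard ∧ H.IsIsomorphic (tournamentT H.vertexSet.ncard).cThree

/-! ### The construction `Γ • ℍ` -/

namespace SimpleGraph

/-- The number `v(C)` of vertices of a component `C`. -/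
noncomputable def ConnectedComponent.order {V : Type*} {Γ : SimpleGraph V}
    (C : Γ.ConnectedComponent) : ℕ :=
  C.supp.ncard

/-- All the components of `Γ` are paths. -/
def ComponentsArePaths {V : Type*} (Γ : SimpleGraph V) : Prop :=
  ∀ C : Γ.ConnectedComponent, Nonempty (pathGraph C.order ≃g C.toSimpleGraph)

/-- The nondegeneracy conditions on `Γ`: some component is nontrivial (has at least two
vertices); if an odd component `C` misses a vertex, then there is a nontrivial component other
than `C`; if an even component `C` misses two vertices, then there is a nontrivial component other
than `C`. -/
def IsNondegenerate {V : Type*} (Γ : SimpleGraph V) : Prop :=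
  (∃ C : Γ.ConnectedComponent, C.order ≠ 1) ∧
  (∀ C : Γ.ConnectedComponent, Odd C.order → (Set.univ \ C.supp).Nonempty →
    ∃ D : Γ.ConnectedComponent, D ≠ C ∧ D.order ≠ 1) ∧
  (∀ C : Γ.ConnectedComponent, Even C.order → 2 ≤ (Set.univ \ C.supp).ncard →
    ∃ D : Γ.ConnectedComponent, D ≠ C ∧ D.order ≠ 1)

/-- The parity conditions on a `{2,3}`-hypergraph `ℍ` on the set of components of `Γ`: each edge
of size `2` contains an even and an odd component, and each edge of size `3` consists of odd
components. -/
def ParityConditions {V : Type*} (Γ : SimpleGraph V) (ℍ : Hypergraph Γ.ConnectedComponent) :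
    Prop :=
  (∀ ε ∈ ℍ.edgeSet, ε.ncard = 2 → (∃ C ∈ ε, Even C.order) ∧ (∃ D ∈ ε, Odd D.order)) ∧
  (∀ ε ∈ ℍ.edgeSet, ε.ncard = 3 → ∀ C ∈ ε, Odd C.order)

/-- A choice, for each component `C` of `Γ`, of an isomorphism `φ C` from the path on
`{0, …, v(C) - 1}` onto `C`. -/
abbrev PathLabelling {V : Type*} (Γ : SimpleGraph V) : Type _ :=
  ∀ C : Γ.ConnectedComponent, pathGraph C.order ≃g C.toSimpleGraph

/-- The edges `E_C` given by an odd nontrivial component `C`: the image under `φ C` of the edges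
of `C₃(U_{v(C)})`. -/
def componentEdges {V : Type*} {Γ : SimpleGraph V} (φ : Γ.PathLabelling)
    (C : Γ.ConnectedComponent) : Set (Set V) :=
  {e | ∃ X ∈ (tournamentU C.order).cThree.edgeSet, e = (fun x => (φ C x : V)) '' X}

/-- The edges `φ_C(2i) φ_C(2j+1) φ_D(2k)` with `i ≤ j`, given by an edge `{C, D}` of `ℍ`, where
`C` is even and `D` is odd. As `x`, `y`, `z` run over the vertices of the paths, the bounds
`j ≤ w(C) - 1` and `k ≤ w(D)` hold automatically. -/
def pairEdges {V : Type*} {Γ : SimpleGraph V} (φ : Γ.PathLabelling)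
    (C D : Γ.ConnectedComponent) : Set (Set V) :=
  {e | ∃ (x y : Fin C.order) (z : Fin D.order) (i j k : ℕ),
    x.val = 2 * i ∧ y.val = 2 * j + 1 ∧ z.val = 2 * k ∧ i ≤ j ∧
      e = {(φ C x : V), (φ C y : V), (φ D z : V)}}

/-- The edges `φ_I(2i) φ_J(2j) φ_K(2k)` given by an edge `{I, J, K}` of `ℍ`, where `I`, `J`, `K`
are odd. -/
def tripleEdges {V : Type*} {Γ : SimpleGraph V} (φ : Γ.PathLabelling)
    (I J K : Γ.ConnectedComponent) : Set (Set V) :=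
  {e | ∃ (x : Fin I.order) (y : Fin J.order) (z : Fin K.order) (i j k : ℕ),
    x.val = 2 * i ∧ y.val = 2 * j ∧ z.val = 2 * k ∧
      e = {(φ I x : V), (φ J y : V), (φ K z : V)}}

/-- The `3`-hypergraph `Γ • ℍ`, defined on the vertex set of `Γ` by means of the isomorphisms
`φ C` from paths onto the components of `Γ`. -/
def bullet {V : Type*} (Γ : SimpleGraph V) (ℍ : Hypergraph Γ.ConnectedComponent)
    (φ : Γ.PathLabelling) : Hypergraph V where
  vertexSet := Set.univ
  edgeSet :=
    {e | ∃ C : Γ.ConnectedComponent, Odd C.order ∧ C.order ≠ 1 ∧ e ∈ componentEdges φ C} ∪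
    {e | ∃ C D : Γ.ConnectedComponent, Even C.order ∧ Odd D.order ∧
      {C, D} ∈ ℍ.edgeSet ∧ e ∈ pairEdges φ C D} ∪
    {e | ∃ I J K : Γ.ConnectedComponent, Odd I.order ∧ Odd J.order ∧ Odd K.order ∧
      I ≠ J ∧ I ≠ K ∧ J ≠ K ∧ {I, J, K} ∈ ℍ.edgeSet ∧ e ∈ tripleEdges φ I J K}
  subset_vertexSet_of_mem_edgeSet' := fun _ _ => Set.subset_univ _

end SimpleGraph

/-! The hypergraph is handled as a symmetric ternary relation (`TripleSystem`). Everything rests on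
a local fact. Let `Y` induce a prime subsystem. If adding a vertex `a` destroys primality, then `a`
either has no edge with two vertices of `Y` (`Free`) or has the same link in `Y` as a unique `y`
(`Twin`).

Applied to `Y = V ∖ {v, w}` in a critical system, this fact describes the primality graph
(`Critical.adj_cases`). Every vertex has degree at most two, the two neighbours of a vertex are
twins away from it, and every edge at the neighbour of a leaf contains the leaf. So the components
are paths and cycles along which a vertex of an edge can be moved in steps of two.

On a path, such moves bring every edge to a normal form (`IsStrand.single`, `IsStrand.pair`,
`IsStrand.triple`). The parities of the positions and of the length are forced, and one edge of a
given kind yields all edges of that kind. This is exactly the shape of `Γ • ℍ`. On a cycle, the same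
moves show that the length is odd, that the cycle covers `V`, and that the edges are those of
`C₃(T_n)`, which is the circular case.

Condition (2) needs a global result, `exists_primeOn_compl_pair`: outside every proper prime
subsystem of a critical system there is an edge of the primality graph. It comes from an exchange
argument on a maximal proper prime subsystem. It is applied to a single edge, to an odd component,
and to an even component with one extra vertex, all of which are prime. -/

/-- A `3`-hypergraph on the vertex set `V`, presented by the symmetric ternary relation
`{a, b, c}` is an edge. -/
structure TripleSystem (V : Type*) where
  E : V → V → V → Prop
  swap : ∀ {a b c}, E a b c → E b a c
  rot : ∀ {a b c}, E a b c → E b c a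
  irrefl : ∀ a b, ¬ E a a b

/-! ### Prime subsystems and their extensions by one or two vertices. -/

namespace TripleSystem

variable {V : Type*} (T : TripleSystem V)

lemma swap_iff (a b c : V) : T.E a b c ↔ T.E b a c := ⟨T.swap, T.swap⟩

lemma rot_iff (a b c : V) : T.E a b c ↔ T.E b c a := ⟨T.rot, fun h => T.rot (T.rot h)⟩

/-- `M` is a module of the subsystem induced by `S`. -/
def IsMod (S M : Set V) : Prop :=
  M ⊆ S ∧ ∀ m ∈ M, ∀ n ∈ M, ∀ x ∈ S, x ∉ M →
    ¬ T.E m n x ∧ ∀ y ∈ S, y ∉ M → T.E m x y → T.E n x y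

/-- The subsystem induced by `S` is prime. -/
def PrimeOn (S : Set V) : Prop :=
  (∃ a ∈ S, ∃ b ∈ S, ∃ c ∈ S, a ≠ b ∧ a ≠ c ∧ b ≠ c) ∧
    ∀ M, T.IsMod S M → M.Subsingleton ∨ M = S

/-- The vertex `a ∉ Y` has the same link in `Y` as `y`. -/
def Twin (Y : Set V) (y a : V) : Prop :=
  y ∈ Y ∧ a ∉ Y ∧ ∀ u ∈ Y, ∀ v ∈ Y, (T.E y u v ↔ T.E a u v)

/-- The vertex `a ∉ Y` has an empty link in `Y`. -/
def Free (Y : Set V) (a : V) : Prop :=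
  a ∉ Y ∧ ∀ u ∈ Y, ∀ v ∈ Y, ¬ T.E a u v

variable {T} {S Y M : Set V} {y z a b c : V}

lemma IsMod.inter (h : T.IsMod S M) (hY : Y ⊆ S) : T.IsMod Y (M ∩ Y) := by
  obtain ⟨h1, h2⟩ := h
  refine ⟨Set.inter_subset_right, fun m hm n hn x hx hxM => ?_⟩
  have := h2 m hm.1 n hn.1 x (hY hx) (fun h => hxM ⟨h, hx⟩)
  exact ⟨this.1, fun w hw hwM => this.2 w (hY hw) (fun h => hwM ⟨h, hw⟩)⟩

/-- The trace of a module on a prime subsystem is a module there, hence trivial. Every extension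
argument below splits along these three cases. -/
lemma PrimeOn.inter_cases (hY : T.PrimeOn Y) (h : T.IsMod S M) (hS : Y ⊆ S) :
    (∀ t ∈ Y, t ∉ M) ∨ Y ⊆ M ∨ ∃ t ∈ Y, t ∈ M ∧ ∀ s ∈ Y, s ∈ M → s = t := by
  rcases hY.2 _ (h.inter hS) with h | h
  · by_cases hne : ∃ t ∈ Y, t ∈ M
    · obtain ⟨t, ht, htM⟩ := hne
      exact .inr (.inr ⟨t, ht, htM, fun s hs hsM => h ⟨hsM, hs⟩ ⟨htM, ht⟩⟩)
    · push Not at hne; exact .inl hne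
  · exact .inr (.inl (by rw [← h]; exact Set.inter_subset_left))

lemma PrimeOn.exists_ne (hY : T.PrimeOn Y) (a b : V) : ∃ c ∈ Y, c ≠ a ∧ c ≠ b := by
  obtain ⟨⟨p, hp, q, hq, r, hr, h1, h2, h3⟩, -⟩ := hY
  by_cases hpa : p = a <;> by_cases hpb : p = b <;> by_cases hqa : q = a <;>
    by_cases hqb : q = b <;> grind

/-- If `y` were on no edge inside `Y`, then `Y ∖ {y}` would be a nontrivial module. -/
lemma PrimeOn.exists_edge (hY : T.PrimeOn Y) (hy : y ∈ Y) :
    ∃ u ∈ Y, ∃ v ∈ Y, u ≠ y ∧ v ≠ y ∧ u ≠ v ∧ T.E y u v := by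
  by_contra! hcon
  have hE : ∀ u ∈ Y, ∀ v ∈ Y, ¬ T.E y u v := by
    intro u hu v hv h
    have h1 := T.irrefl y
    have h2 := T.irrefl u
    have h3 := @T.rot
    have h4 := @T.swap
    refine hcon u hu v hv ?_ ?_ ?_ h <;> rintro rfl <;> grind
  have hM : T.IsMod Y (Y \ {y}) := by
    refine ⟨Set.sdiff_subset, fun m hm n hn x hx hxM => ?_⟩
    have : x = y := by by_contra h; exact hxM ⟨hx, h⟩
    subst this
    exact ⟨fun h => hE m hm.1 n hn.1 (T.rot (T.rot h)), fun w hw _ h =>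
      absurd (T.swap h) (hE m hm.1 w hw)⟩
  rcases hY.2 _ hM with h | h
  · obtain ⟨p, hp, hpy, -⟩ := hY.exists_ne y y
    obtain ⟨q, hq, hqy, hqp⟩ := hY.exists_ne y p
    exact hqp (h ⟨hq, hqy⟩ ⟨hp, hpy⟩)
  · have : y ∈ Y \ {y} := by rw [h]; exact hy
    exact this.2 rfl

/-- Distinct vertices of a prime subsystem have distinct links. -/
lemma PrimeOn.eq_of_link (hY : T.PrimeOn Y) (hy : y ∈ Y) (hz : z ∈ Y)
    (h : ∀ u ∈ Y, ∀ v ∈ Y, u ≠ y → v ≠ y → (T.E z u v ↔ T.E y u v)) : y = z := by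
  by_contra hne
  have h3 := @T.rot
  have h4 := @T.swap
  have h1 := @T.irrefl
  have hM : T.IsMod Y {y, z} := by
    refine ⟨by grind, fun m hm n hn x hx hxM => ?_⟩
    simp only [Set.mem_insert_iff, Set.mem_singleton_iff, not_or] at hm hn hxM
    -- Taking `z` as one of the two link vertices, the hypothesis compares `E y x z` with the
    -- degenerate `E z x z`, which fails.
    have key : ¬ T.E y z x := by
      intro hh
      have := h x hx z hz hxM.1 (Ne.symm hne)
      grind
    refine ⟨by grind, fun w hw hwM => ?_⟩
    simp only [Set.mem_insert_iff, Set.mem_singleton_iff, not_or] at hwM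
    have := h x hx w hw hxM.1 hwM.1
    grind
  obtain ⟨c, hc, hcy, hcz⟩ := hY.exists_ne y z
  rcases hY.2 _ hM with h | h
  · exact hne (h (by simp) (by simp))
  · rw [← h] at hc; grind

lemma PrimeOn.twin_unique (hY : T.PrimeOn Y) (h1 : T.Twin Y y a) (h2 : T.Twin Y z a) : y = z :=
  hY.eq_of_link h1.1 h2.1 fun u hu v hv _ _ => (h2.2.2 u hu v hv).trans (h1.2.2 u hu v hv).symm

lemma PrimeOn.not_free_of_twin (hY : T.PrimeOn Y) (h1 : T.Twin Y y a) : ¬ T.Free Y a := by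
  intro h2
  obtain ⟨u, hu, v, hv, -, -, -, h⟩ := hY.exists_edge h1.1
  exact h2.2 u hu v hv ((h1.2.2 u hu v hv).1 h)

lemma mem_of_not_subsingleton (hsub : M ⊆ insert a (insert b Y)) (hs : ¬ M.Subsingleton)
    (h : ∀ t ∈ Y, t ∉ M) : a ∈ M ∧ b ∈ M := by
  rw [Set.not_subsingleton_iff] at hs
  obtain ⟨p, hp, q, hq, hpq⟩ := hs
  have hp' := hsub hp
  have hq' := hsub hq
  grind

lemma mem_or_mem_of_not_subsingleton (hsub : M ⊆ insert a (insert b Y)) (hs : ¬ M.Subsingleton)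
    (h : ∀ t ∈ Y, t ∈ M → t = y) : a ∈ M ∨ b ∈ M := by
  rw [Set.not_subsingleton_iff] at hs
  obtain ⟨p, hp, q, hq, hpq⟩ := hs
  have hp' := hsub hp
  have hq' := hsub hq
  grind

lemma PrimeOn.three_insert (hY : T.PrimeOn Y) (hS : Y ⊆ S) :
    ∃ a ∈ S, ∃ b ∈ S, ∃ c ∈ S, a ≠ b ∧ a ≠ c ∧ b ≠ c := by
  obtain ⟨⟨p, hp, q, hq, r, hr, h⟩, -⟩ := hY
  exact ⟨p, hS hp, q, hS hq, r, hS hr, h⟩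

/-- A one-vertex extension of a prime subsystem that is not prime. -/
lemma PrimeOn.free_or_twin (hY : T.PrimeOn Y) (ha : a ∉ Y) (hn : ¬ T.PrimeOn (insert a Y)) :
    T.Free Y a ∨ ∃ y, T.Twin Y y a := by
  have : ∃ M, T.IsMod (insert a Y) M ∧ ¬ M.Subsingleton ∧ M ≠ insert a Y := by
    by_contra h
    simp only [not_exists, not_and, not_not] at h
    exact hn ⟨hY.three_insert (Set.subset_insert _ _), fun M hM => by
      by_contra! hc
      exact hc.2 (h M hM (Set.not_subsingleton_iff.2 hc.1))⟩
  obtain ⟨M, hM, hs, hne⟩ := this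
  have h1 := @T.irrefl
  have h3 := @T.rot
  have h4 := @T.swap
  have hsub := hM.1
  rcases hY.inter_cases hM (Set.subset_insert _ _) with h | h | ⟨t, ht, htM, h⟩
  -- The three traces of `M` on `Y` give in turn: `M ⊆ {a}`, which is trivial; `M = Y`, so `a` is
  -- free; `M = {t, a}`, so `a` is a twin of `t`.
  · exact absurd (fun p hp q hq => by have := hsub hp; have := hsub hq; grind) hs
  · left
    have haM : a ∉ M := fun haM => hne (hsub.antisymm (Set.insert_subset haM h))
    exact ⟨ha, fun u hu v hv hE =>
      (hM.2 u (h hu) v (h hv) a (by simp) haM).1 (T.rot hE)⟩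
  · right
    have haM : a ∈ M := by
      by_contra haM
      exact hs fun p hp q hq => by have := hsub hp; have := hsub hq; grind
    have key : ∀ u ∈ Y, u ≠ t → ¬ T.E t a u := fun u hu hut =>
      (hM.2 t htM a haM u (by simp [hu]) (fun hh => hut (h u hu hh))).1
    refine ⟨t, ht, ha, fun u hu v hv => ?_⟩
    by_cases hut : u = t
    · subst hut; have := key v hv; grind
    by_cases hvt : v = t
    · subst hvt; have := key u hu; grind
    have hu' : u ∉ M := fun hh => hut (h u hu hh)
    have hv' : v ∉ M := fun hh => hvt (h v hv hh)
    exact ⟨(hM.2 t htM a haM u (by simp [hu]) hu').2 v (by simp [hv]) hv',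
      (hM.2 a haM t htM u (by simp [hu]) hu').2 v (by simp [hv]) hv'⟩

/-- The restrictions on the edges `{a, b, u}`, `u ∈ Y`, for two vertices `a`, `b` outside a prime
subsystem `Y`. -/
structure Tame (T : TripleSystem V) (Y : Set V) (a b : V) : Prop where
  left : ∀ y, T.Twin Y y a → ¬ T.Twin Y y b → ∀ u ∈ Y, (T.E a b u ↔ T.E y b u)
  right : ∀ y, T.Twin Y y b → ¬ T.Twin Y y a → ∀ u ∈ Y, (T.E a b u ↔ T.E a y u)
  both : ∀ y, T.Twin Y y a → T.Twin Y y b → ∀ u ∈ Y, u ≠ y → ¬ T.E a b u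
  free : T.Free Y a → T.Free Y b → ∀ u ∈ Y, ∀ v ∈ Y, T.E a b u → T.E a b v

/-- Let `M` be a nontrivial module of `Y ∪ {a, b}`. Trace `∅` would make `b` a twin of `y`. With
trace `Y`, the module contains `a` but not `b`, and both sides fail. With trace `{t}`, either `a ∈
M`, `t = y` and `a` may be exchanged for `y`, or `b` is a twin of `t` and `E a b u`, `E a t u`, `E y
t u`, `E y b u` are equivalent. -/
lemma PrimeOn.tame_left (hY : T.PrimeOn Y) (hM : T.IsMod (insert a (insert b Y)) M)
    (hs : ¬ M.Subsingleton) (hne : M ≠ insert a (insert b Y))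
    (ha : T.Twin Y y a) (hb : T.Free Y b ∨ ∃ z, T.Twin Y z b) (hby : ¬ T.Twin Y y b) :
    ∀ u ∈ Y, (T.E a b u ↔ T.E y b u) := by
  have h1 := @T.irrefl
  have h3 := @T.rot
  have h4 := @T.swap
  have hsub := hM.1
  have hbY : b ∉ Y := by
    rcases hb with hb | ⟨z, hb⟩
    exacts [hb.1, hb.2.1]
  have hm := hM.2
  rcases hY.inter_cases hM (by grind) with h | h | ⟨t, ht, htM, h⟩
  · obtain ⟨haM, hbM⟩ := mem_of_not_subsingleton hsub hs h
    refine absurd ⟨ha.1, hbY, fun u hu v hv => (ha.2.2 u hu v hv).trans ?_⟩ hby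
    exact ⟨(hm a haM b hbM u (by simp [hu]) (h u hu)).2 v (by simp [hv]) (h v hv),
      (hm b hbM a haM u (by simp [hu]) (h u hu)).2 v (by simp [hv]) (h v hv)⟩
  · have haM : a ∈ M := by
      by_contra haM
      obtain ⟨u, hu, v, hv, -, -, -, hE⟩ := hY.exists_edge ha.1
      refine (hm u (h hu) v (h hv) a (by simp) haM).1 (T.rot ((ha.2.2 u hu v hv).1 hE))
    have hbM : b ∉ M := by
      intro hbM
      exact hne (hsub.antisymm (Set.insert_subset haM (Set.insert_subset hbM h)))
    intro u hu
    have e1 := (hm a haM u (h hu) b (by simp) hbM).1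
    have e2 := (hm y (h ha.1) u (h hu) b (by simp) hbM).1
    grind
  · by_cases haM : a ∈ M
    · have hta : T.Twin Y t a := by
        have key : ∀ u ∈ Y, u ≠ t → ¬ T.E t a u := fun u hu hut =>
          (hm t htM a haM u (by simp [hu]) (fun hh => hut (h u hu hh))).1
        refine ⟨ht, ha.2.1, fun u hu v hv => ?_⟩
        by_cases hut : u = t
        · subst hut; have := key v hv; grind
        by_cases hvt : v = t
        · subst hvt; have := key u hu; grind
        have hu' : u ∉ M := fun hh => hut (h u hu hh)
        have hv' : v ∉ M := fun hh => hvt (h v hv hh)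
        exact ⟨(hm t htM a haM u (by simp [hu]) hu').2 v (by simp [hv]) hv',
          (hm a haM t htM u (by simp [hu]) hu').2 v (by simp [hv]) hv'⟩
      obtain rfl := hY.twin_unique ha hta
      by_cases hbM : b ∈ M
      · have htb : T.Twin Y y b := by
          have key : ∀ u ∈ Y, u ≠ y → ¬ T.E y b u := fun u hu hut =>
            (hm y htM b hbM u (by simp [hu]) (fun hh => hut (h u hu hh))).1
          refine ⟨ht, hbY, fun u hu v hv => ?_⟩
          by_cases hut : u = y
          · subst hut; have := key v hv; grind
          by_cases hvt : v = y
          · subst hvt; have := key u hu; grind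
          have hu' : u ∉ M := fun hh => hut (h u hu hh)
          have hv' : v ∉ M := fun hh => hvt (h v hv hh)
          exact ⟨(hm y htM b hbM u (by simp [hu]) hu').2 v (by simp [hv]) hv',
            (hm b hbM y htM u (by simp [hu]) hu').2 v (by simp [hv]) hv'⟩
        exact absurd htb hby
      · intro u hu
        by_cases huy : u = y
        · subst huy
          have := (hm a haM u htM b (by simp) hbM).1
          grind
        · have hu' : u ∉ M := fun hh => huy (h u hu hh)
          exact ⟨(hm a haM y htM b (by simp) hbM).2 u (by simp [hu]) hu',
            (hm y htM a haM b (by simp) hbM).2 u (by simp [hu]) hu'⟩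
    · have hbM : b ∈ M := (mem_or_mem_of_not_subsingleton hsub hs h).resolve_left haM
      have key : ∀ u ∈ Y, u ≠ t → ¬ T.E t b u := fun u hu hut =>
          (hm t htM b hbM u (by simp [hu]) (fun hh => hut (h u hu hh))).1
      have htb : T.Twin Y t b := by
        refine ⟨ht, hbY, fun u hu v hv => ?_⟩
        by_cases hut : u = t
        · subst hut; have := key v hv; grind
        by_cases hvt : v = t
        · subst hvt; have := key u hu; grind
        have hu' : u ∉ M := fun hh => hut (h u hu hh)
        have hv' : v ∉ M := fun hh => hvt (h v hv hh)
        exact ⟨(hm t htM b hbM u (by simp [hu]) hu').2 v (by simp [hv]) hv',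
          (hm b hbM t htM u (by simp [hu]) hu').2 v (by simp [hv]) hv'⟩
      have hty : t ≠ y := by rintro rfl; exact hby htb
      intro u hu
      have e0 := ha.2.2 u hu t ht
      have e1 := htb.2.2 y ha.1 u hu
      by_cases hut : u = t
      · subst hut
        have := (hm u htM b hbM a (by simp) haM).1
        grind
      · have hu' : u ∉ M := fun hh => hut (h u hu hh)
        have e2 := (hm b hbM t htM a (by simp) haM).2 u (by simp [hu]) hu'
        have e3 := (hm t htM b hbM a (by simp) haM).2 u (by simp [hu]) hu'
        grind

lemma PrimeOn.tame_both (hY : T.PrimeOn Y) (hM : T.IsMod (insert a (insert b Y)) M)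
    (hs : ¬ M.Subsingleton) (hne : M ≠ insert a (insert b Y))
    (ha : T.Twin Y y a) (hb : T.Twin Y y b) :
    ∀ u ∈ Y, u ≠ y → ¬ T.E a b u := by
  have h1 := @T.irrefl
  have h3 := @T.rot
  have h4 := @T.swap
  have hsub := hM.1
  have hm := hM.2
  have haY := ha.2.1
  have hbY := hb.2.1
  obtain ⟨p, hp, q, hq, -, -, -, hE⟩ := hY.exists_edge ha.1
  have hEa := (ha.2.2 p hp q hq).1 hE
  have hEb := (hb.2.2 p hp q hq).1 hE
  rcases hY.inter_cases hM (by grind) with h | h | ⟨t, ht, htM, h⟩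
  · obtain ⟨haM, hbM⟩ := mem_of_not_subsingleton hsub hs h
    exact fun u hu _ => (hm a haM b hbM u (by simp [hu]) (h u hu)).1
  · have haM : a ∈ M := by
      by_contra haM
      exact (hm p (h hp) q (h hq) a (by simp) haM).1 (T.rot hEa)
    have hbM : b ∈ M := by
      by_contra hbM
      exact (hm p (h hp) q (h hq) b (by simp) hbM).1 (T.rot hEb)
    exact absurd (hsub.antisymm (Set.insert_subset haM (Set.insert_subset hbM h))) hne
  · have aux : ∀ c, c ∈ M → T.Twin Y y c → t = y := by
      intro c hcM hc
      have hcY := hc.2.1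
      refine hY.eq_of_link ht hc.1 fun u hu v hv hut hvt => ?_
      have hu' : u ∉ M := fun hh => hut (h u hu hh)
      have hv' : v ∉ M := fun hh => hvt (h v hv hh)
      exact (hc.2.2 u hu v hv).trans
        ⟨(hm c hcM t htM u (by simp [hu]) hu').2 v (by simp [hv]) hv',
          (hm t htM c hcM u (by simp [hu]) hu').2 v (by simp [hv]) hv'⟩
    intro u hu huy
    have ea := ha.2.2 y ha.1 u hu
    have eb := hb.2.2 y ha.1 u hu
    by_cases haM : a ∈ M
    · obtain rfl := aux a haM ha
      have hu' : u ∉ M := fun hh => huy (h u hu hh)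
      by_cases hbM : b ∈ M
      · exact (hm a haM b hbM u (by simp [hu]) hu').1
      · have := (hm a haM t htM b (by simp) hbM).2 u (by simp [hu]) hu'
        grind
    · have hbM : b ∈ M := (mem_or_mem_of_not_subsingleton hsub hs h).resolve_left haM
      obtain rfl := aux b hbM hb
      have hu' : u ∉ M := fun hh => huy (h u hu hh)
      have := (hm b hbM t htM a (by simp) haM).2 u (by simp [hu]) hu'
      grind

/-- Either `Y` itself is the module, and `u` may be exchanged for `v`, or the module excludes every
edge `{a, b, u}`. A one-point trace `{t}` cannot occur, since a free vertex cannot share the link of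
`t`. -/
lemma PrimeOn.tame_free (hY : T.PrimeOn Y) (hM : T.IsMod (insert a (insert b Y)) M)
    (hs : ¬ M.Subsingleton) (hne : M ≠ insert a (insert b Y))
    (ha : T.Free Y a) (hb : T.Free Y b) :
    ∀ u ∈ Y, ∀ v ∈ Y, T.E a b u → T.E a b v := by
  have h1 := @T.irrefl
  have h3 := @T.rot
  have h4 := @T.swap
  have hsub := hM.1
  have hm := hM.2
  intro u hu v hv hE
  rcases hY.inter_cases hM (by grind) with h | h | ⟨t, ht, htM, h⟩
  · obtain ⟨haM, hbM⟩ := mem_of_not_subsingleton hsub hs h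
    exact absurd hE (hm a haM b hbM u (by simp [hu]) (h u hu)).1
  · by_cases haM : a ∈ M
    · have hbM : b ∉ M := fun hbM => hne (hsub.antisymm (Set.insert_subset haM (Set.insert_subset hbM h)))
      have := (hm a haM u (h hu) b (by simp) hbM).1
      grind
    · by_cases hbM : b ∈ M
      · have := (hm b hbM u (h hu) a (by simp) haM).1
        grind
      · have := (hm u (h hu) v (h hv) a (by simp) haM).2 b (by simp) hbM
        grind
  · obtain ⟨p, hp, q, hq, hpt, hqt, -, hE'⟩ := hY.exists_edge ht
    have hp' : p ∉ M := fun hh => hpt (h p hp hh)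
    have hq' : q ∉ M := fun hh => hqt (h q hq hh)
    by_cases haM : a ∈ M
    · exact absurd ((hm t htM a haM p (by simp [hp]) hp').2 q (by simp [hq]) hq' hE')
        (ha.2 p hp q hq)
    · have hbM : b ∈ M := (mem_or_mem_of_not_subsingleton hsub hs h).resolve_left haM
      exact absurd ((hm t htM b hbM p (by simp [hp]) hp').2 q (by simp [hq]) hq' hE')
        (hb.2 p hp q hq)

/-- A two-vertex extension of a prime subsystem that is not prime. -/
lemma PrimeOn.tame (hY : T.PrimeOn Y) (ha : T.Free Y a ∨ ∃ z, T.Twin Y z a)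
    (hb : T.Free Y b ∨ ∃ z, T.Twin Y z b) (hn : ¬ T.PrimeOn (insert a (insert b Y))) :
    T.Tame Y a b := by
  have : ∃ M, T.IsMod (insert a (insert b Y)) M ∧ ¬ M.Subsingleton ∧
      M ≠ insert a (insert b Y) := by
    by_contra h
    simp only [not_exists, not_and, not_not] at h
    exact hn ⟨hY.three_insert (by grind), fun M hM => by
      by_contra! hc
      exact hc.2 (h M hM (Set.not_subsingleton_iff.2 hc.1))⟩
  obtain ⟨M, hM, hs, hne⟩ := this
  refine ⟨fun y h1 h2 => hY.tame_left hM hs hne h1 hb h2, fun y h1 h2 u hu => ?_,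
    fun y h1 h2 => hY.tame_both hM hs hne h1 h2, hY.tame_free hM hs hne⟩
  rw [Set.insert_comm] at hM hne
  rw [T.swap_iff, hY.tame_left hM hs hne h1 ha h2 u hu, T.swap_iff]


/-! ### Exchange arguments and maximal proper prime subsystems. -/

/-- Replacing a vertex of a prime subsystem by a twin. -/
lemma PrimeOn.replace (hY : T.PrimeOn Y) (ha : T.Twin Y y a) :
    T.PrimeOn (insert a (Y \ {y})) := by
  classical
  have h1 := @T.irrefl
  have h3 := @T.rot
  have h4 := @T.swap
  obtain ⟨hy, haY, hE⟩ := ha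
  have hya : y ≠ a := by rintro rfl; exact haY hy
  -- The transposition of `a` and `y` maps the subsystem on `Y` isomorphically onto the one on `(Y ∖
  -- {y}) ∪ {a}`, so modules can be pulled back.
  have key : ∀ u ∈ Y, ∀ v ∈ Y, ∀ w ∈ Y,
      (T.E u v w ↔ T.E (Equiv.swap a y u) (Equiv.swap a y v) (Equiv.swap a y w)) := by
    intro u hu v hv w hw
    have hua : u ≠ a := by rintro rfl; exact haY hu
    have hva : v ≠ a := by rintro rfl; exact haY hv
    have hwa : w ≠ a := by rintro rfl; exact haY hw
    have e1 := hE v hv w hw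
    have e2 := hE w hw u hu
    have e3 := hE u hu v hv
    by_cases hu' : u = y <;> by_cases hv' : v = y <;> by_cases hw' : w = y <;>
      simp only [hu', hv', hw', Equiv.swap_apply_right, ne_eq, not_false_eq_true,
        Equiv.swap_apply_of_ne_of_ne hua, Equiv.swap_apply_of_ne_of_ne hva,
        Equiv.swap_apply_of_ne_of_ne hwa] <;> clear hE <;> subst_vars <;> grind
  set f := Equiv.swap a y with hf
  have hfY : ∀ u ∈ Y, f u ∈ insert a (Y \ {y}) := by
    intro u hu
    by_cases hu' : u = y
    · simp [hf, hu']
    · rw [hf, Equiv.swap_apply_of_ne_of_ne (by rintro rfl; exact haY hu) hu']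
      exact .inr ⟨hu, hu'⟩
  have hff : ∀ u, f (f u) = u := fun u => Equiv.swap_apply_self a y u
  have hfY' : ∀ u ∈ insert a (Y \ {y}), f u ∈ Y := by
    rintro u (rfl | ⟨hu, hu'⟩)
    · simp [hf, hy]
    · rw [hf, Equiv.swap_apply_of_ne_of_ne (by rintro rfl; exact haY hu) hu']
      exact hu
  refine ⟨?_, fun M hM => ?_⟩
  · obtain ⟨⟨p, hp, q, hq, r, hr, h⟩, -⟩ := hY
    exact ⟨f p, hfY p hp, f q, hfY q hq, f r, hfY r hr, by simpa using h⟩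
  · have hM' : T.IsMod Y (f ⁻¹' M) := by
      refine ⟨fun u hu => by simpa [hff] using hfY' _ (hM.1 hu), fun m hm n hn x hx hxM => ?_⟩
      have hmY : m ∈ Y := by simpa [hff] using hfY' _ (hM.1 hm)
      have hnY : n ∈ Y := by simpa [hff] using hfY' _ (hM.1 hn)
      have := hM.2 _ hm _ hn _ (hfY x hx) hxM
      rw [key m hmY n hnY x hx]
      refine ⟨this.1, fun w hw hwM => ?_⟩
      rw [key m hmY x hx w hw, key n hnY x hx w hw]
      exact this.2 _ (hfY w hw) hwM
    rcases hY.2 _ hM' with h | h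
    · left
      intro p hp q hq
      exact f.symm.injective (h (by simpa using hp) (by simpa using hq))
    · right
      refine hM.1.antisymm fun u hu => ?_
      have : f u ∈ f ⁻¹' M := by rw [h]; exact hfY' u hu
      simpa [hff] using this

section Untame

variable (hY : T.PrimeOn Y)
  (h1 : ∀ d ∉ Y, ¬ T.PrimeOn (insert d Y))
  (h2 : ∀ d ∉ Y, ∀ e ∉ Y, ¬ T.PrimeOn (insert d (insert e Y)))
include hY h1 h2

/-- Let `Y' = (Y ∖ {y}) ∪ {a}`, again prime. Outside `Y'`, the vertices `b` and `c` keep the type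
(free, or twin of a given vertex) that they have over `Y`, with `a` in the role of `y`. If `Y' ∪ {b,
c}` were not prime, tameness over `Y'` would restrict `E a b c` just as tameness over `Y` restricts
`E y b c`, and the two would agree. -/
lemma PrimeOn.exchange_of_untame (ha : T.Twin Y y a) (hb : b ∉ Y) (hc : c ∉ Y)
    (hcy : ¬ T.Twin Y y c) (hbad : ¬ (T.E a b c ↔ T.E y b c)) :
    T.PrimeOn (insert b (insert c (insert a (Y \ {y})))) := by
  have s1 := T.irrefl
  have s3 := @T.rot
  have s4 := @T.swap
  by_contra hn
  have hft : ∀ d ∉ Y, T.Free Y d ∨ ∃ z, T.Twin Y z d := fun d hd => hY.free_or_twin hd (h1 d hd)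
  have htame : ∀ d ∉ Y, ∀ e ∉ Y, T.Tame Y d e := fun d hd e he =>
    hY.tame (hft d hd) (hft e he) (h2 d hd e he)
  have haY := ha.2.1
  have hyY := ha.1
  have hY' := hY.replace ha
  have hab : a ≠ b := by
    rintro rfl
    have := (htame a haY c hc).left y ha hcy y ha.1
    grind
  have hac : a ≠ c := by rintro rfl; exact hcy ha
  -- Types transfer from `Y` to `Y'`. Only pairs containing the new vertex `a` have to be checked,
  -- and tameness of the pair `a`, `d` over `Y` settles them.
  have hfree : ∀ d ∉ Y, d ≠ a → T.Free Y d → T.Free (insert a (Y \ {y})) d := by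
    intro d hd hda hfr
    have ht := (htame a haY d hd).left y ha (fun h => hY.not_free_of_twin h hfr)
    refine ⟨by grind, ?_⟩
    have hfr' := hfr.2
    have key : ∀ u ∈ Y, ¬ T.E d a u := by
      intro u hu
      have := ht u hu
      have := hfr' y hyY u hu
      grind
    rintro u (rfl | ⟨hu, -⟩) v (rfl | ⟨hv, -⟩)
    · grind
    · exact key v hv
    · have := key u hu; grind
    · exact hfr' u hu v hv
  have htwin : ∀ d ∉ Y, d ≠ a → ∀ z, z ≠ y → T.Twin Y z d →
      T.Twin (insert a (Y \ {y})) z d := by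
    intro d hd hda z hzy hz
    have hzY := hz.1
    have ht := (htame a haY d hd).left y ha (fun h => hzy (hY.twin_unique hz h))
    refine ⟨.inr ⟨hzY, hzy⟩, by grind, ?_⟩
    have key : ∀ u ∈ Y, T.E z a u ↔ T.E d a u := by
      intro u hu
      have e1 := ht u hu
      have e2 := hz.2.2 y hyY u hu
      have e3 := ha.2.2 z hzY u hu
      grind
    rintro u (rfl | ⟨hu, -⟩) v (rfl | ⟨hv, -⟩)
    · grind
    · exact key v hv
    · have := key u hu; grind
    · exact hz.2.2 u hu v hv
  have htwin' : ∀ d ∉ Y, d ≠ a → T.Twin Y y d → T.Twin (insert a (Y \ {y})) a d := by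
    intro d hd hda hz
    have ht := (htame a haY d hd).both y ha hz
    refine ⟨.inl rfl, by grind, ?_⟩
    rintro u (rfl | ⟨hu, hu'⟩) v (rfl | ⟨hv, hv'⟩)
    · grind
    · have := ht v hv hv'; grind
    · have := ht u hu hu'; grind
    · exact (ha.2.2 u hu v hv).symm.trans (hz.2.2 u hu v hv)
  have hft' : ∀ d ∉ Y, d ≠ a → T.Free (insert a (Y \ {y})) d ∨
      ∃ z, T.Twin (insert a (Y \ {y})) z d := by
    intro d hd hda
    rcases hft d hd with h | ⟨z, h⟩
    · exact .inl (hfree d hd hda h)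
    · by_cases hzy : z = y
      · subst hzy; exact .inr ⟨a, htwin' d hd hda h⟩
      · exact .inr ⟨z, htwin d hd hda z hzy h⟩
  have htame' := hY'.tame (hft' b hb hab.symm) (hft' c hc hac.symm) hn
  have htbc := htame b hb c hc
  have haY' : a ∈ insert a (Y \ {y}) := .inl rfl
  -- Types transfer back from `Y'` to `Y` as well, because the type over a prime subsystem is
  -- unique.
  have hca : ¬ T.Twin (insert a (Y \ {y})) a c := by
    intro h
    rcases hft c hc with h' | ⟨z, h'⟩
    · exact hY'.not_free_of_twin h (hfree c hc hac.symm h')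
    · by_cases hzy : z = y
      · subst hzy; exact hcy h'
      · exact haY (by rw [hY'.twin_unique h (htwin c hc hac.symm z hzy h')]; exact h'.1)
  by_cases hby : T.Twin Y y b
  · have e1 := htame'.left a (htwin' b hb hab.symm hby) hca a haY'
    have e2 := htbc.left y hby hcy y hyY
    grind
  have hcz : ∀ z, z ≠ y → (T.Twin (insert a (Y \ {y})) z c → T.Twin Y z c) := by
    intro z hzy hz
    rcases hft c hc with h' | ⟨w, h'⟩
    · exact absurd (hfree c hc hac.symm h') (hY'.not_free_of_twin hz)
    · by_cases hwy : w = y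
      · subst hwy; exact absurd h' hcy
      · rw [hY'.twin_unique hz (htwin c hc hac.symm w hwy h')]; exact h'
  have hbz : ∀ z, z ≠ y → (T.Twin (insert a (Y \ {y})) z b → T.Twin Y z b) := by
    intro z hzy hz
    rcases hft b hb with h' | ⟨w, h'⟩
    · exact absurd (hfree b hb hab.symm h') (hY'.not_free_of_twin hz)
    · by_cases hwy : w = y
      · subst hwy; exact absurd h' hby
      · rw [hY'.twin_unique hz (htwin b hb hab.symm w hwy h')]; exact h'
  rcases hft b hb with hbf | ⟨z, hz⟩
  · rcases hft c hc with hcf | ⟨w, hw⟩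
    · obtain ⟨u, hu, huy, -⟩ := hY.exists_ne y y
      have hu' : u ∈ insert a (Y \ {y}) := .inr ⟨hu, huy⟩
      have f1 := htame'.free (hfree b hb hab.symm hbf) (hfree c hc hac.symm hcf)
      have f2 := htbc.free hbf hcf
      have e1 := f1 a haY' u hu'
      have e2 := f1 u hu' a haY'
      have e3 := f2 y hyY u hu
      have e4 := f2 u hu y hyY
      grind
    · have hwy : w ≠ y := by rintro rfl; exact hcy hw
      have hwb : ¬ T.Twin Y w b := fun h => hY.not_free_of_twin h hbf
      have e1 := htame'.right w (htwin c hc hac.symm w hwy hw) (fun h => hwb (hbz w hwy h)) a haY'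
      have e2 := htbc.right w hw hwb y hyY
      have e3 := (htame a haY b hb).left y ha hby w hw.1
      grind
  · have hzy : z ≠ y := by rintro rfl; exact hby hz
    by_cases hcz' : T.Twin Y z c
    · have e1 := htame'.both z (htwin b hb hab.symm z hzy hz) (htwin c hc hac.symm z hzy hcz')
        a haY' (by rintro rfl; exact haY hz.1)
      have e2 := htbc.both z hz hcz' y hyY hzy.symm
      grind
    · have e1 := htame'.left z (htwin b hb hab.symm z hzy hz) (fun h => hcz' (hcz z hzy h)) a haY'
      have e2 := htbc.left z hz hcz' y hyY
      have e3 := (htame a haY c hc).left y ha hcy z hz.1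
      grind

/-- If adding `y` back destroyed primality, `y` would be free over the exchanged set or a twin of
some `s` in it. An edge at `y` inside `Y` excludes the former, and each possible `s` contradicts a
hypothesis or the distinctness of links in `Y`. -/
lemma PrimeOn.insert_of_untame (ha : T.Twin Y y a) (hb : b ∉ Y) (hc : c ∉ Y)
    (hcy : ¬ T.Twin Y y c) (hbad : ¬ (T.E a b c ↔ T.E y b c)) :
    T.PrimeOn (insert y (insert b (insert c (insert a (Y \ {y}))))) := by
  have s1 := T.irrefl
  have s3 := @T.rot
  have s4 := @T.swap
  have hft : ∀ d ∉ Y, T.Free Y d ∨ ∃ z, T.Twin Y z d := fun d hd => hY.free_or_twin hd (h1 d hd)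
  have htame : ∀ d ∉ Y, ∀ e ∉ Y, T.Tame Y d e := fun d hd e he =>
    hY.tame (hft d hd) (hft e he) (h2 d hd e he)
  have hyY := ha.1
  have haY := ha.2.1
  by_contra hn
  have hY'' := hY.exchange_of_untame h1 h2 ha hb hc hcy hbad
  set Y'' := insert b (insert c (insert a (Y \ {y}))) with hdef
  have hsub : ∀ u ∈ Y, u ≠ y → u ∈ Y'' := fun u hu huy => .inr (.inr (.inr ⟨hu, huy⟩))
  have haY'' : a ∈ Y'' := by simp [hdef]
  have hbY'' : b ∈ Y'' := by simp [hdef]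
  have hcY'' : c ∈ Y'' := by simp [hdef]
  have hyY'' : y ∉ Y'' := by rintro (rfl | rfl | rfl | h) <;> grind
  rcases hY''.free_or_twin hyY'' hn with h | ⟨s, hs, -, h⟩
  · obtain ⟨u, hu, v, hv, huy, hvy, -, hE⟩ := hY.exists_edge hyY
    exact h.2 u (hsub u hu huy) v (hsub v hv hvy) hE
  -- The link of `y` in `Y` only uses vertices of `Y ∖ {y} ⊆ Y''`, so it identifies the type of `d`
  -- over `Y`.
  · have aux : ∀ d ∉ Y, (∀ u ∈ Y'', ∀ v ∈ Y'', T.E d u v ↔ T.E y u v) → T.Twin Y y d := by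
      intro d hd hdE
      rcases hft d hd with hf | ⟨z, hz⟩
      · obtain ⟨u, hu, v, hv, huy, hvy, -, hE⟩ := hY.exists_edge hyY
        exact absurd ((hdE u (hsub u hu huy) v (hsub v hv hvy)).2 hE) (hf.2 u hu v hv)
      · have : y = z := hY.eq_of_link hyY hz.1 fun u hu v hv huy hvy =>
          (hz.2.2 u hu v hv).trans (hdE u (hsub u hu huy) v (hsub v hv hvy))
        rwa [this]
    rcases hs with rfl | rfl | rfl | ⟨hs, hsy⟩
    -- If `s = b`, then `b` is a twin of `y` over `Y`, and tameness makes both `E a b c` and `E y b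
    -- c` fail.
    · have e1 := htame a haY c hc |>.left y ha hcy y hyY
      have e2 := h a haY'' c hcY''
      have e3 := htame _ hb c hc |>.left y (aux _ hb h) hcy y hyY
      grind
    · exact hcy (aux _ hc h)
    · exact hbad (h b hbY'' c hcY'')
    · exact hsy (hY.eq_of_link hyY hs fun u hu v hv huy hvy =>
        h u (hsub u hu huy) v (hsub v hv hvy)).symm

end Untame

/-- In a critical system, a proper prime subsystem misses two vertices whose removal leaves a
prime system. -/
theorem exists_primeOn_compl_pair [Finite V] (hV : T.PrimeOn Set.univ)
    (hcrit : ∀ v, ¬ T.PrimeOn {v}ᶜ) {X : Set V} (hX : T.PrimeOn X) (hXne : X ≠ Set.univ) :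
    ∃ v w, v ∉ X ∧ w ∉ X ∧ v ≠ w ∧ T.PrimeOn {v, w}ᶜ := by
  -- Let `Y` be a maximal proper prime subsystem containing `X`. A prime extension of `Y` by one or
  -- two vertices would be everything. The first case contradicts criticality and the second gives
  -- the required pair.
  obtain ⟨Y, hXY, hYmax⟩ := Set.Finite.exists_le_maximal (Set.toFinite
    {Y : Set V | T.PrimeOn Y ∧ Y ≠ Set.univ}) (show X ∈ _ from ⟨hX, hXne⟩)
  obtain ⟨⟨hY, hYne⟩, hmax⟩ := hYmax
  by_contra hcon
  have s1 := T.irrefl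
  have s3 := @T.rot
  have s4 := @T.swap
  have hmax' : ∀ Z, T.PrimeOn Z → Y ⊂ Z → Z = Set.univ := by
    intro Z hZ hYZ
    by_contra hne
    exact hYZ.2 (hmax ⟨hZ, hne⟩ hYZ.1)
  have h1 : ∀ d ∉ Y, ¬ T.PrimeOn (insert d Y) := by
    intro d hd hp
    have := hmax' _ hp (Set.ssubset_insert hd)
    refine hcrit d ?_
    convert hY
    ext u
    have : u ∈ insert d Y := by rw [this]; trivial
    grind
  have h2 : ∀ d ∉ Y, ∀ e ∉ Y, ¬ T.PrimeOn (insert d (insert e Y)) := by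
    intro d hd e he hp
    by_cases hde : d = e
    · subst hde
      rw [Set.insert_eq_of_mem (Set.mem_insert _ _)] at hp
      exact h1 d hd hp
    have := hmax' _ hp ((Set.ssubset_insert he).trans_subset (Set.subset_insert _ _))
    refine hcon ⟨d, e, fun h => hd (hXY h), fun h => he (hXY h), hde, ?_⟩
    convert hY
    ext u
    have : u ∈ insert d (insert e Y) := by rw [this]; trivial
    grind
  have hft : ∀ d ∉ Y, T.Free Y d ∨ ∃ z, T.Twin Y z d := fun d hd => hY.free_or_twin hd (h1 d hd)
  have htame : ∀ d ∉ Y, ∀ e ∉ Y, T.Tame Y d e := fun d hd e he =>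
    hY.tame (hft d hd) (hft e he) (h2 d hd e he)
  -- If all outer vertices are free, tameness makes `Y` itself a module of the whole system.
  by_cases hall : ∀ d ∉ Y, T.Free Y d
  · have hM : T.IsMod Set.univ Y := by
      refine ⟨Set.subset_univ _, fun m hm n hn x _ hx => ⟨fun h => ?_, fun w _ hw h => ?_⟩⟩
      · exact (hall x hx).2 m hm n hn (T.rot (T.rot h))
      · exact T.rot (T.rot ((htame x hx w hw).free (hall x hx) (hall w hw) m hm n hn (T.rot h)))
    rcases hV.2 _ hM with h | h
    · obtain ⟨⟨p, hp, q, hq, r, hr, h12, -⟩, -⟩ := hY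
      exact h12 (h hp hq)
    · exact hYne h
  · push Not at hall
    obtain ⟨a, haY, haf⟩ := hall
    obtain ⟨y, hya⟩ := (hft a haY).resolve_left haf
    have hyY := hya.1
    -- Otherwise `y` together with all its twins would be a nontrivial module: tameness covers the
    -- triples meeting `Y`, and `hno` covers those outside.
    have hbad : ∃ a b c, T.Twin Y y a ∧ b ∉ Y ∧ c ∉ Y ∧ ¬ T.Twin Y y c ∧
        ¬ (T.E a b c ↔ T.E y b c) := by
      by_contra! hno
      have hM : T.IsMod Set.univ {v | v = y ∨ T.Twin Y y v} := by
        have out : ∀ m, T.Twin Y y m → ∀ x, x ≠ y → ¬ T.Twin Y y x → ∀ w, T.E m x w ↔ T.E y x w := by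
          intro m hm x hxy hx w
          have hmY := hm.2.1
          by_cases hxY : x ∈ Y
          · by_cases hwY : w ∈ Y
            · exact (hm.2.2 x hxY w hwY).symm
            · by_cases hwt : T.Twin Y y w
              · have e1 := (htame m hmY w hwY).both y hm hwt x hxY hxy
                have e2 := hwt.2.2 y hyY x hxY
                grind
              · have := (htame m hmY w hwY).left y hm hwt x hxY
                grind
          · by_cases hwY : w ∈ Y
            · exact (htame m hmY x hxY).left y hm hx w hwY
            · have := hno m w x hm hwY hxY hx
              grind
        have out' : ∀ m ∈ {v | v = y ∨ T.Twin Y y v}, ∀ x, x ≠ y → ¬ T.Twin Y y x → ∀ w,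
            T.E m x w ↔ T.E y x w := by
          rintro m (rfl | hm) x hxy hx w
          · rfl
          · exact out m hm x hxy hx w
        refine ⟨Set.subset_univ _, fun m hm n hn x _ hx => ?_⟩
        simp only [Set.mem_ofPred_eq, not_or] at hx
        refine ⟨fun h => ?_, fun w _ hw h => ?_⟩
        · have e1 := (out' m hm x hx.1 hx.2 n).1 (by grind)
          have e2 := (out' n hn x hx.1 hx.2 y).1 (by grind)
          grind
        · exact (out' n hn x hx.1 hx.2 w).2 ((out' m hm x hx.1 hx.2 w).1 h)
      rcases hV.2 _ hM with h | h
      · have : y = a := h (.inl rfl) (.inr hya)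
        exact haY (this ▸ hyY)
      · obtain ⟨u, hu, huy, -⟩ := hY.exists_ne y y
        have : u ∈ {v | v = y ∨ T.Twin Y y v} := by rw [h]; trivial
        rcases this with h' | h'
        exacts [huy h', h'.2.1 hu]
    obtain ⟨a, b, c, ha, hb, hc, hcy, hbad⟩ := hbad
    have p1 := hY.exchange_of_untame h1 h2 ha hb hc hcy hbad
    have p2 := hY.insert_of_untame h1 h2 ha hb hc hcy hbad
    have haY := ha.2.1
    -- The set in `p2` strictly contains `Y`, so it is everything. Hence the prime set in `p1` is
    -- the complement of `y`, against criticality.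
    have huniv := hmax' _ p2 (by
      refine Set.ssubset_iff_subset_ne.2 ⟨fun u hu => ?_, fun h => hb (by rw [h]; simp)⟩
      by_cases huy : u = y
      · simp [huy]
      · simp [hu, huy])
    refine hcrit y ?_
    convert p1
    ext u
    have : u ∈ insert y (insert b (insert c (insert a (Y \ {y})))) := by rw [huniv]; trivial
    have hya : y ≠ a := fun h => haY (h ▸ ha.1)
    have hyb : y ≠ b := fun h => hb (h ▸ ha.1)
    have hyc : y ≠ c := fun h => hc (h ▸ ha.1)
    simp only [Set.mem_insert_iff, Set.mem_sdiff, Set.mem_singleton_iff, Set.mem_compl_iff] at this ⊢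
    clear * - this hya hyb hyc
    grind


/-! ### The primality graph of a critical system: degrees, leaves and twins. -/

lemma primeOn_of_edge (h : T.E a b c) : T.PrimeOn {a, b, c} := by
  have s1 := T.irrefl
  have s3 := @T.rot
  have s4 := @T.swap
  have hab : a ≠ b := by rintro rfl; exact s1 _ _ h
  have hac : a ≠ c := by rintro rfl; exact s1 _ _ (T.rot (T.rot h))
  have hbc : b ≠ c := by rintro rfl; exact s1 _ _ (T.rot h)
  refine ⟨⟨a, by simp, b, by simp, c, by simp, hab, hac, hbc⟩, fun M hM => ?_⟩
  by_contra! hcon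
  obtain ⟨⟨m, hm, n, hn, hmn⟩, hne⟩ := hcon
  obtain ⟨x, hx, hxM⟩ : ∃ x ∈ ({a, b, c} : Set V), x ∉ M := by
    by_contra! hsub
    exact hne (hM.1.antisymm hsub)
  have := (hM.2 m hm n hn x hx hxM).1
  have hm' := hM.1 hm
  have hn' := hM.1 hn
  have hmx : m ≠ x := by rintro rfl; exact hxM hm
  have hnx : n ≠ x := by rintro rfl; exact hxM hn
  simp only [Set.mem_insert_iff, Set.mem_singleton_iff] at hx hm' hn'
  clear hM hne
  rcases hx with rfl | rfl | rfl <;> rcases hm' with rfl | rfl | rfl <;>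
    rcases hn' with rfl | rfl | rfl <;> first | contradiction | grind

/-- The system is prime and loses primality whenever a vertex is deleted. -/
def Critical (T : TripleSystem V) : Prop :=
  T.PrimeOn Set.univ ∧ ∀ v, ¬ T.PrimeOn {v}ᶜ

/-- The primality graph of a triple system. -/
def primalityGraph (T : TripleSystem V) : SimpleGraph V where
  Adj v w := v ≠ w ∧ T.PrimeOn {v, w}ᶜ
  symm := ⟨fun v w h => ⟨h.1.symm, by rw [Set.pair_comm]; exact h.2⟩⟩
  loopless := ⟨fun _ h => h.1 rfl⟩

lemma Critical.exists_adj_outside [Finite V] (hT : T.Critical) {X : Set V} (hX : T.PrimeOn X)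
    (hXne : X ≠ Set.univ) : ∃ v w, v ∉ X ∧ w ∉ X ∧ T.primalityGraph.Adj v w := by
  obtain ⟨v, w, hv, hw, hne, h⟩ := exists_primeOn_compl_pair hT.1 hT.2 hX hXne
  exact ⟨v, w, hv, hw, hne, h⟩

/-- The neighbours of a vertex in the primality graph of a critical system. -/
lemma Critical.adj_cases (hT : T.Critical) (h : T.primalityGraph.Adj v w) :
    ((∀ z, T.primalityGraph.Adj v z → z = w) ∧ ∀ x u, T.E w x u → x = v ∨ u = v) ∨
    ∃ y, y ≠ w ∧ T.primalityGraph.Adj v y ∧ (∀ z, T.primalityGraph.Adj v z → z = w ∨ z = y) ∧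
      ∀ x u, x ≠ v → u ≠ v → x ≠ w → u ≠ w → (T.E y x u ↔ T.E w x u) := by
  have s1 := T.irrefl
  have s3 := @T.rot
  have s4 := @T.swap
  obtain ⟨hne, hY⟩ := h
  have hins : insert w ({v, w}ᶜ : Set V) = {v}ᶜ := by
    ext u; simp only [Set.mem_insert_iff, Set.mem_compl_iff, Set.mem_singleton_iff]; grind
  have hmem : ∀ u, u ∈ ({v, w}ᶜ : Set V) ↔ u ≠ v ∧ u ≠ w := by intro u; simp
  -- `V ∖ {v}` is the extension of the prime `V ∖ {v, w}` by `w`, and it is not prime, so `w` is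
  -- free or a twin.
  rcases hY.free_or_twin (a := w) (by simp) (by rw [hins]; exact hT.2 v) with hf | ⟨y, hy⟩
  · left
    have key : ∀ x u, T.E w x u → x = v ∨ u = v := by
      intro x u hE
      by_contra! hc
      refine hf.2 x ((hmem x).2 ⟨hc.1, ?_⟩) u ((hmem u).2 ⟨hc.2, ?_⟩) hE
      · rintro rfl; exact s1 _ _ hE
      · rintro rfl; exact s1 _ _ (T.rot (T.rot hE))
    refine ⟨fun z hz => ?_, key⟩
    by_contra hzw
    -- For another neighbour `z` of `v`, the vertex `w` lies on an edge of the prime `V ∖ {v, z}`,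
    -- and that edge avoids `v`.
    obtain ⟨p, hp, q, hq, -, -, -, hE⟩ := hz.2.exists_edge (y := w) (by simp [Ne.symm hzw, hne.symm])
    have := key p q hE
    simp only [Set.mem_compl_iff, Set.mem_insert_iff, Set.mem_singleton_iff] at hp hq
    grind
  · right
    obtain ⟨hyv, hyw⟩ := (hmem y).1 hy.1
    have key : ∀ x u, x ≠ v → u ≠ v → x ≠ w → u ≠ w → (T.E y x u ↔ T.E w x u) :=
      fun x u hx hu hx' hu' => hy.2.2 x ((hmem x).2 ⟨hx, hx'⟩) u ((hmem u).2 ⟨hu, hu'⟩)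
    refine ⟨y, hyw, ⟨hyv.symm, ?_⟩, fun z hz => ?_, key⟩
    -- Replacing `y` by its twin `w` turns `V ∖ {v, w}` into `V ∖ {v, y}`.
    · convert hY.replace hy using 1
      ext u
      simp only [Set.mem_compl_iff, Set.mem_insert_iff, Set.mem_singleton_iff, Set.mem_sdiff]
      grind
    -- For a third neighbour `z`, the prime `V ∖ {v, z}` would contain both `w` and `y`, with equal
    -- links.
    · by_contra! hzz
      refine hyw (hz.2.eq_of_link (y := w) (z := y) ?_ ?_ fun u hu x hx huw hxw => ?_).symm
      · simp [hne.symm, hzz.1.symm]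
      · simp [hyv, hzz.2.symm]
      · simp only [Set.mem_compl_iff, Set.mem_insert_iff, Set.mem_singleton_iff, not_or] at hu hx
        exact key u x hu.1 hx.1 huw hxw

lemma Critical.leaf (hT : T.Critical) (h : T.primalityGraph.Adj v w)
    (hv : ∀ z, T.primalityGraph.Adj v z → z = w) {x u : V} (hE : T.E w x u) : x = v ∨ u = v := by
  rcases hT.adj_cases h with h' | ⟨y, hyw, hy, -⟩
  · exact h'.2 x u hE
  · exact absurd (hv y hy) hyw

lemma Critical.eq_or_eq_of_adj (hT : T.Critical) (hy : T.primalityGraph.Adj v y)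
    (hw : T.primalityGraph.Adj v w) (hne : y ≠ w) (hz : T.primalityGraph.Adj v z) :
    z = y ∨ z = w := by
  rcases hT.adj_cases hw with h' | ⟨y', hyw, hy', h', -⟩
  · exact absurd (h'.1 y hy) hne
  · have e1 := h' y hy
    have e2 := h' z hz
    grind

lemma Critical.twins (hT : T.Critical) (hy : T.primalityGraph.Adj v y)
    (hw : T.primalityGraph.Adj v w) (hne : y ≠ w) {x u : V} (hxv : x ≠ v) (huv : u ≠ v)
    (hxy : x ≠ y) (huy : u ≠ y) : T.E y x u ↔ T.E w x u := by
  rcases hT.adj_cases hy with h' | ⟨w', hwy, -, h', h''⟩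
  · exact absurd (h'.1 w hw).symm hne
  · have : w = w' := by have := h' w hw; grind
    subst this
    exact (h'' x u hxv huv hxy huy).symm

/-! ### Strands: the edges seen from a path component. -/

/-- Sliding a vertex of an edge along consecutive twins. -/
lemma slide {c : ℕ → V} {i : ℕ} (k : ℕ) {x u : V}
    (hstep : ∀ j, i ≤ j → j + 2 ≤ i + 2 * k → ∀ x u, x ≠ c j → u ≠ c j → x ≠ c (j + 1) →
      u ≠ c (j + 1) → (T.E (c j) x u ↔ T.E (c (j + 2)) x u))
    (hx : ∀ j, i ≤ j → j < i + 2 * k → x ≠ c j) (hu : ∀ j, i ≤ j → j < i + 2 * k → u ≠ c j) :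
    T.E (c i) x u ↔ T.E (c (i + 2 * k)) x u := by
  induction k with
  | zero => simp
  | succ k ih =>
    rw [ih (fun j h1 h2 => hstep j h1 (by omega)) (fun j h1 h2 => hx j h1 (by omega))
      (fun j h1 h2 => hu j h1 (by omega))]
    exact hstep (i + 2 * k) (by omega) (by omega) x u (hx _ (by omega) (by omega))
      (hu _ (by omega) (by omega)) (hx _ (by omega) (by omega)) (hu _ (by omega) (by omega))

/-- The sequence `c 0, …, c (n - 1)` behaves like a path component of the primality graph of a
critical system. -/
structure IsStrand (T : TripleSystem V) (c : ℕ → V) (n : ℕ) : Prop where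
  inj : ∀ i < n, ∀ j < n, c i = c j → i = j
  step : ∀ i, i + 2 < n → ∀ x u, x ≠ c i → u ≠ c i → x ≠ c (i + 1) → u ≠ c (i + 1) →
    (T.E (c i) x u ↔ T.E (c (i + 2)) x u)
  left : 2 ≤ n → ∀ x u, T.E (c 1) x u → x = c 0 ∨ u = c 0
  right : 2 ≤ n → ∀ x u, T.E (c (n - 2)) x u → x = c (n - 1) ∨ u = c (n - 1)

namespace IsStrand

variable {c : ℕ → V} {n i j k : ℕ} {x u : V}

/-- The end position `c j` need not be avoided by `x` and `u`; `odd_gap` relies on this to slide one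
vertex of an edge onto another. -/
lemma slide (h : T.IsStrand c n) (hij : i ≤ j) (hpar : Even (j - i)) (hj : j < n)
    (hx : ∀ l, i ≤ l → l < j → x ≠ c l) (hu : ∀ l, i ≤ l → l < j → u ≠ c l) :
    T.E (c i) x u ↔ T.E (c j) x u := by
  obtain ⟨k, hk⟩ := hpar
  obtain rfl : j = i + 2 * k := by omega
  exact TripleSystem.slide k (fun l h1 h2 => h.step l (by omega)) hx hu

lemma ne (h : T.IsStrand c n) (hi : i < n) (hj : j < n) (hij : i ≠ j) : c i ≠ c j :=
  fun e => hij (h.inj i hi j hj e)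

/-- With an even gap, `c i` could slide onto `c j`, giving an edge with a repeated vertex. -/
lemma odd_gap (h : T.IsStrand c n) (hij : i < j) (hj : j < n)
    (hx : ∀ l, i ≤ l → l < j → x ≠ c l) (hE : T.E (c i) (c j) x) : Odd (j - i) := by
  by_contra hc
  rw [Nat.not_odd_iff_even] at hc
  rw [h.slide hij.le hc hj (fun l h1 h2 => h.ne hj (by omega) (by omega)) hx] at hE
  exact T.irrefl _ _ hE

/-- Edges meeting a strand in one vertex. -/
lemma single (h : T.IsStrand c n) (hi : i < n) (hx : ∀ l < n, x ≠ c l) (hu : ∀ l < n, u ≠ c l)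
    (hE : T.E (c i) x u) :
    Odd n ∧ Even i ∧ ∀ j < n, Even j → T.E (c j) x u := by
  have hie : Even i := by
    by_contra ho
    rw [Nat.not_even_iff_odd] at ho
    obtain ⟨m, hm⟩ := ho
    -- From an odd position the vertex slides down to `c 1`, and every edge at `c 1` contains `c 0`.
    rw [← h.slide (i := 1) (by omega) ⟨m, by omega⟩ hi (fun l _ _ => hx l (by omega))
      (fun l _ _ => hu l (by omega))] at hE
    rcases h.left (by omega) _ _ hE with e | e
    exacts [hx 0 (by omega) e, hu 0 (by omega) e]
  have h0 : T.E (c 0) x u := (h.slide (by omega) (by simpa using hie) hi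
    (fun l _ _ => hx l (by omega)) (fun l _ _ => hu l (by omega))).2 hE
  have hall : ∀ j < n, Even j → T.E (c j) x u := fun j hj hje =>
    (h.slide (by omega) (by simpa using hje) hj
      (fun l _ _ => hx l (by omega)) (fun l _ _ => hu l (by omega))).1 h0
  refine ⟨?_, hie, hall⟩
  by_contra hn
  rw [Nat.not_odd_iff_even] at hn
  obtain ⟨m, hm⟩ := hn
  -- For even `n`, the position `n - 2` is even, and every edge at `c (n - 2)` contains `c (n - 1)`.
  rcases h.right (by omega) _ _ (hall (n - 2) (by omega) ⟨m - 1, by omega⟩) with e | e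
  exacts [hx _ (by omega) e, hu _ (by omega) e]

/-- Edges meeting a strand in two vertices. -/
lemma pair (h : T.IsStrand c n) (hij : i < j) (hj : j < n) (hx : ∀ l < n, x ≠ c l)
    (hE : T.E (c i) (c j) x) :
    Even n ∧ Even i ∧ Odd j ∧
      ∀ p q, p < q → q < n → Even p → Odd q → T.E (c p) (c q) x := by
  obtain ⟨m, hm⟩ := h.odd_gap hij hj (fun l _ _ => hx l (by omega)) hE
  have hie : Even i := by
    by_contra ho
    rw [Nat.not_even_iff_odd] at ho
    obtain ⟨m', hm'⟩ := ho
    rw [← h.slide (i := 1) (by omega) ⟨m', by omega⟩ (by omega)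
      (fun l _ _ => h.ne hj (by omega) (by omega)) (fun l _ _ => hx l (by omega))] at hE
    rcases h.left (by omega) _ _ hE with e | e
    exacts [h.ne hj (by omega) (by omega) e, hx 0 (by omega) e]
  obtain ⟨m', hm'⟩ := hie
  have hne : Even n := by
    by_contra hn
    rw [Nat.not_even_iff_odd] at hn
    obtain ⟨r, hr⟩ := hn
    rw [T.swap_iff, h.slide (j := n - 2) (by omega) ⟨r - 1 - (m + m'), by omega⟩ (by omega)
      (fun l _ _ => h.ne (by omega) (by omega) (by omega)) (fun l _ _ => hx l (by omega))] at hE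
    rcases h.right (by omega) _ _ hE with e | e
    exacts [h.ne (by omega) (by omega) (by omega) e, hx _ (by omega) e]
  obtain ⟨r, hr⟩ := hne
  -- Normal form: the lower vertex slides down to `c 0` and the upper one up to `c (n - 1)`, so they
  -- never cross.
  have key : ∀ p q, p < q → q < n → Even p → Odd q →
      (T.E (c p) (c q) x ↔ T.E (c 0) (c (n - 1)) x) := by
    rintro p q hpq hq ⟨p', hp⟩ ⟨q', hq'⟩
    rw [← h.slide (i := 0) (j := p) (by omega) ⟨p', by omega⟩ (by omega)
      (fun l _ _ => h.ne hq (by omega) (by omega)) (fun l _ _ => hx l (by omega)), T.swap_iff,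
      h.slide (i := q) (j := n - 1) (by omega) ⟨r - 1 - q', by omega⟩ (by omega)
      (fun l _ _ => h.ne (by omega) (by omega) (by omega)) (fun l _ _ => hx l (by omega)),
      T.swap_iff]
  have hio : Even i := ⟨m', hm'⟩
  have hjo : Odd j := ⟨m + m', by omega⟩
  refine ⟨⟨r, hr⟩, hio, hjo, fun p q hpq hq hp hq' => ?_⟩
  rw [key p q hpq hq hp hq', ← key i j hij hj hio hjo]
  exact hE

/-- Edges contained in a strand. -/
lemma triple (h : T.IsStrand c n) (hij : i < j) (hjk : j < k) (hk : k < n)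
    (hE : T.E (c i) (c j) (c k)) :
    Odd n ∧ Even i ∧ Odd j ∧ Even k ∧
      ∀ p q r, p < q → q < r → r < n → Even p → Odd q → Even r → T.E (c p) (c q) (c r) := by
  obtain ⟨m, hm⟩ := h.odd_gap hij (by omega)
    (fun l _ _ => h.ne hk (by omega) (by omega)) hE
  obtain ⟨m2, hm2⟩ := h.odd_gap hjk hk
    (fun l _ _ => h.ne (by omega) (by omega) (by omega)) (T.rot hE)
  have hie : Even i := by
    by_contra ho
    rw [Nat.not_even_iff_odd] at ho
    obtain ⟨m', hm'⟩ := ho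
    rw [← h.slide (i := 1) (by omega) ⟨m', by omega⟩ (by omega)
      (fun l _ _ => h.ne (by omega) (by omega) (by omega))
      (fun l _ _ => h.ne (by omega) (by omega) (by omega))] at hE
    rcases h.left (by omega) _ _ hE with e | e
    exacts [h.ne (by omega) (by omega) (by omega) e, h.ne (by omega) (by omega) (by omega) e]
  obtain ⟨m', hm'⟩ := hie
  have hno : Odd n := by
    by_contra hn
    rw [Nat.not_odd_iff_even] at hn
    obtain ⟨r, hr⟩ := hn
    rw [← T.rot_iff, h.slide (j := n - 2) (by omega) ⟨r - 1 - (m + m' + m2 + 1), by omega⟩ (by omega)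
      (fun l _ _ => h.ne (by omega) (by omega) (by omega))
      (fun l _ _ => h.ne (by omega) (by omega) (by omega))] at hE
    rcases h.right (by omega) _ _ hE with e | e
    exacts [h.ne (by omega) (by omega) (by omega) e, h.ne (by omega) (by omega) (by omega) e]
  obtain ⟨r, hr⟩ := hno
  -- Normal form `0, 1, n - 1`. The lowest vertex moves first, which clears the way for the middle
  -- one to descend to `c 1`.
  have key : ∀ p q s, p < q → q < s → s < n → Even p → Odd q → Even s →
      (T.E (c p) (c q) (c s) ↔ T.E (c 0) (c 1) (c (n - 1))) := by
    rintro p q s hpq hqs hs ⟨p', hp⟩ ⟨q', hq'⟩ ⟨s', hs'⟩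
    rw [← h.slide (i := 0) (j := p) (by omega) ⟨p', by omega⟩ (by omega)
      (fun l _ _ => h.ne (by omega) (by omega) (by omega))
      (fun l _ _ => h.ne (by omega) (by omega) (by omega)), T.swap_iff,
      ← h.slide (i := 1) (j := q) (by omega) ⟨q', by omega⟩ (by omega)
      (fun l _ _ => h.ne (by omega) (by omega) (by omega))
      (fun l _ _ => h.ne (by omega) (by omega) (by omega)), T.swap_iff, ← T.rot_iff,
      h.slide (i := s) (j := n - 1) (by omega) ⟨r - s', by omega⟩ (by omega)
      (fun l _ _ => h.ne (by omega) (by omega) (by omega))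
      (fun l _ _ => h.ne (by omega) (by omega) (by omega)), T.rot_iff]
  have hio : Even i := ⟨m', hm'⟩
  have hjo : Odd j := ⟨m + m', by omega⟩
  have hko : Even k := ⟨m + m' + m2 + 1, by omega⟩
  refine ⟨⟨r, hr⟩, hio, hjo, hko, fun p q s hpq hqs hs hp hq hs' => ?_⟩
  rw [key p q s hpq hqs hs hp hq hs', ← key i j k hij hjk hk hio hjo hko]
  exact hE

end IsStrand

lemma IsMod.mem_of_edge (hM : T.IsMod S M) (ha : a ∈ M) (hb : b ∈ M) (hz : z ∈ S)
    (hE : T.E a b z) : z ∈ M := by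
  by_contra h
  exact (hM.2 a ha b hb z hz h).1 hE

/-- To prove primality it suffices to consider modules with two elements. -/
lemma primeOn_of_forall_mem (h3 : ∃ a ∈ S, ∃ b ∈ S, ∃ c ∈ S, a ≠ b ∧ a ≠ c ∧ b ≠ c)
    (h : ∀ M, T.IsMod S M → M.Nontrivial → S ⊆ M) : T.PrimeOn S := by
  refine ⟨h3, fun M hM => ?_⟩
  by_cases hs : M.Subsingleton
  · exact .inl hs
  · exact .inr (hM.1.antisymm (h M hM (Set.not_subsingleton_iff.1 hs)))

namespace IsStrand

variable {c : ℕ → V} {n i j k : ℕ} {x u : V}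

/-- Some edge contains `c 1`, hence `c 0`. Its third vertex lies on the strand, since `pair` would
otherwise make `n` even, and `triple` then gives all the other edges. -/
lemma edges_of_odd (h : T.IsStrand c n) (hV : T.PrimeOn Set.univ) (hn : Odd n) (h3 : 3 ≤ n)
    {p q r : ℕ} (hpq : p < q) (hqr : q < r) (hr : r < n) (hp : Even p) (hq : Odd q)
    (hr' : Even r) : T.E (c p) (c q) (c r) := by
  have key : ∀ w, T.E (c 0) (c 1) w → T.E (c p) (c q) (c r) := by
    intro w hE
    by_cases hw : ∃ l < n, w = c l
    · obtain ⟨l, hl, rfl⟩ := hw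
      have h0 : l ≠ 0 := by rintro rfl; exact T.irrefl _ _ (T.rot (T.rot hE))
      have h1 : l ≠ 1 := by rintro rfl; exact T.irrefl _ _ (T.rot hE)
      exact (h.triple (by omega) (by omega) hl hE).2.2.2.2 p q r hpq hqr hr hp hq hr'
    · push Not at hw
      have := (h.pair (by omega) (by omega) hw hE).1
      exact absurd hn (Nat.not_odd_iff_even.2 this)
  obtain ⟨u, -, w, -, -, -, -, hE⟩ := hV.exists_edge (Set.mem_univ (c 1))
  rcases h.left (by omega) _ _ hE with rfl | rfl
  · exact key w (T.swap hE)
  · exact key u (T.rot (T.rot hE))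

/-- An edge at `c 0` meets the strand in exactly two vertices, because `single` and `triple` would
both make `n` odd. -/
lemma edges_of_even (h : T.IsStrand c n) (hV : T.PrimeOn Set.univ) (hn : Even n) (h2 : 2 ≤ n) :
    ∃ x, (∀ l < n, x ≠ c l) ∧
      ∀ p q, p < q → q < n → Even p → Odd q → T.E (c p) (c q) x := by
  have hno : ¬ Odd n := Nat.not_odd_iff_even.2 hn
  obtain ⟨u, -, w, -, hu0, hw0, huw, hE⟩ := hV.exists_edge (Set.mem_univ (c 0))
  by_cases hu : ∃ l < n, u = c l
  · obtain ⟨l, hl, rfl⟩ := hu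
    have h0 : l ≠ 0 := by rintro rfl; exact hu0 rfl
    by_cases hw : ∃ l < n, w = c l
    · obtain ⟨l', hl', rfl⟩ := hw
      have h0' : l' ≠ 0 := by rintro rfl; exact hw0 rfl
      have hll : l ≠ l' := by rintro rfl; exact huw rfl
      rcases hll.lt_or_gt with hlt | hlt
      · exact absurd (h.triple (by omega) hlt hl' hE).1 hno
      · exact absurd (h.triple (by omega) hlt hl (T.swap (T.rot (T.rot hE)))).1 hno
    · push Not at hw
      exact ⟨w, hw, (h.pair (by omega) hl hw hE).2.2.2⟩
  · push Not at hu
    by_cases hw : ∃ l < n, w = c l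
    · obtain ⟨l, hl, rfl⟩ := hw
      have h0 : l ≠ 0 := by rintro rfl; exact hw0 rfl
      exact ⟨u, hu, (h.pair (by omega) hl hu (T.swap (T.rot (T.rot hE)))).2.2.2⟩
    · push Not at hw
      exact absurd (h.single (by omega) hu hw hE).1 hno

/-- The strand carries the edges of `C₃(U_n)`. A module containing two vertices of an edge contains
the third. This spreads a pair of vertices to both ends and then everywhere, except that two odd
positions never share an edge. -/
lemma primeOn_of_odd (h : T.IsStrand c n) (hV : T.PrimeOn Set.univ) (hn : Odd n) (h3 : 3 ≤ n) :
    T.PrimeOn {v | ∃ i < n, v = c i} := by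
  have hmem : ∀ i < n, c i ∈ {v | ∃ i < n, v = c i} := fun i hi => ⟨i, hi, rfl⟩
  refine primeOn_of_forall_mem ⟨c 0, hmem 0 (by omega), c 1, hmem 1 (by omega), c 2,
    hmem 2 (by omega), h.ne (by omega) (by omega) (by omega), h.ne (by omega) (by omega) (by omega),
    h.ne (by omega) (by omega) (by omega)⟩ fun M hM hnt => ?_
  have hE := fun p q r => h.edges_of_odd hV hn h3 (p := p) (q := q) (r := r)
  have f1 : ∀ p q r, p < q → q < r → r < n → Even p → Odd q → Even r →
      c p ∈ M → c q ∈ M → c r ∈ M := fun p q r hpq hqr hr hp hq hr' h1 h2 =>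
    hM.mem_of_edge h1 h2 (hmem r hr) (hE p q r hpq hqr hr hp hq hr')
  have f2 : ∀ p q r, p < q → q < r → r < n → Even p → Odd q → Even r →
      c p ∈ M → c r ∈ M → c q ∈ M := fun p q r hpq hqr hr hp hq hr' h1 h2 =>
    hM.mem_of_edge h2 h1 (hmem q (by omega)) (T.rot (T.rot (hE p q r hpq hqr hr hp hq hr')))
  have f3 : ∀ p q r, p < q → q < r → r < n → Even p → Odd q → Even r →
      c q ∈ M → c r ∈ M → c p ∈ M := fun p q r hpq hqr hr hp hq hr' h1 h2 =>
    hM.mem_of_edge h1 h2 (hmem p (by omega)) (T.rot (hE p q r hpq hqr hr hp hq hr'))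
  obtain ⟨N, hN⟩ := hn
  have hne : Even (n - 1) := ⟨N, by omega⟩
  have e0 : Even 0 := by decide
  have o1 : Odd 1 := by decide
  have ends : ∀ p q, p < n → q < n → Even p → Odd q → c p ∈ M → c q ∈ M →
      c 0 ∈ M ∧ c (n - 1) ∈ M := by
    intro p q hp hq hpe hqo h1 h2
    obtain ⟨q', hq'⟩ := hqo
    obtain ⟨p', hp'⟩ := hpe
    have hqo : Odd q := ⟨q', hq'⟩
    have hpe : Even p := ⟨p', hp'⟩
    rcases lt_or_ge p q with hlt | hge
    · have hl := f1 p q (n - 1) hlt (by omega) (by omega) hpe hqo hne h1 h2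
      have := f2 p (p + 1) (n - 1) (by omega) (by omega) (by omega) hpe hpe.add_one hne h1 hl
      exact ⟨f3 0 (p + 1) (n - 1) (by omega) (by omega) (by omega) e0 hpe.add_one hne this hl, hl⟩
    · have hl := f3 0 q p (by omega) (by omega) hp e0 hqo hpe h2 h1
      exact ⟨hl, f1 0 q (n - 1) (by omega) (by omega) (by omega) e0 hqo hne hl h2⟩
  have finish : c 0 ∈ M ∧ c (n - 1) ∈ M → {v | ∃ i < n, v = c i} ⊆ M := by
    rintro ⟨h0, hl⟩ - ⟨i, hi, rfl⟩
    have hodd : ∀ q < n, Odd q → c q ∈ M := by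
      intro q hq hqo
      obtain ⟨q', hq'⟩ := hqo
      exact f2 0 q (n - 1) (by omega) (by omega) (by omega) e0 ⟨q', hq'⟩ hne h0 hl
    rcases Nat.even_or_odd i with hie | hio
    · obtain ⟨i', hi'⟩ := hie
      by_cases hi0 : i = 0
      · rwa [hi0]
      · exact f1 0 1 i (by omega) (by omega) hi e0 o1 ⟨i', hi'⟩ h0 (hodd 1 (by omega) o1)
    · exact hodd i hi hio
  have main : ∀ p q, p < q → q < n → c p ∈ M → c q ∈ M → {v | ∃ i < n, v = c i} ⊆ M := by
    intro p q hpq hq h1 h2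
    refine finish ?_
    rcases Nat.even_or_odd p with hp | hp <;> rcases Nat.even_or_odd q with hq' | hq'
    · refine ends p (p + 1) (by omega) (by omega) hp hp.add_one h1 ?_
      refine f2 p (p + 1) q (by omega) ?_ (by omega) hp hp.add_one hq' h1 h2
      obtain ⟨a, ha⟩ := hp; obtain ⟨b, hb⟩ := hq'; omega
    · exact ends p q (by omega) (by omega) hp hq' h1 h2
    · exact ends q p (by omega) (by omega) hq' hp h2 h1
    -- Two odd positions `p < q`: if neither `c 0` nor `c (p + 1)` is in `M`, the edge on `0, p, p +
    -- 1` can be moved from `p` to `q`. It becomes an edge whose middle position `p + 1` is even,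
    -- which `triple` forbids.
    · obtain ⟨p', hp'⟩ := id hp
      obtain ⟨q', hq''⟩ := id hq'
      by_cases h0 : c 0 ∈ M
      · exact ends 0 p (by omega) (by omega) e0 hp h0 h1
      by_cases hpp : c (p + 1) ∈ M
      · exact ends (p + 1) p (by omega) (by omega) hp.add_one hp hpp h1
      have e := hE 0 p (p + 1) (by omega) (by omega) (by omega) e0 hp hp.add_one
      have e' := (hM.2 _ h1 _ h2 _ (hmem 0 (by omega)) h0).2 _ (hmem (p + 1) (by omega)) hpp
        (T.swap e)
      have := (h.triple (i := 0) (j := p + 1) (k := q) (by omega) (by omega) hq (T.rot e')).2.2.1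
      exact absurd this (Nat.not_odd_iff_even.2 hp.add_one)
  obtain ⟨m, hm, m', hm', hne'⟩ := hnt
  obtain ⟨p, hp, rfl⟩ := hM.1 hm
  obtain ⟨q, hq, rfl⟩ := hM.1 hm'
  have hpq : p ≠ q := by rintro rfl; exact hne' rfl
  rcases hpq.lt_or_gt with hlt | hlt
  · exact main p q hlt hq hm hm'
  · exact main q p hlt hp hm' hm

lemma primeOn_of_even (h : T.IsStrand c n) (hn : Even n) (h2 : 2 ≤ n) (hx : ∀ l < n, x ≠ c l)
    (hE : ∀ p q, p < q → q < n → Even p → Odd q → T.E (c p) (c q) x) :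
    T.PrimeOn (insert x {v | ∃ i < n, v = c i}) := by
  have hmem : ∀ i < n, c i ∈ insert x {v | ∃ i < n, v = c i} := fun i hi => .inr ⟨i, hi, rfl⟩
  have hxmem : x ∈ insert x {v | ∃ i < n, v = c i} := .inl rfl
  refine primeOn_of_forall_mem ⟨c 0, hmem 0 (by omega), c 1, hmem 1 (by omega), x,
    hxmem, h.ne (by omega) (by omega) (by omega), (hx 0 (by omega)).symm,
    (hx 1 (by omega)).symm⟩ fun M hM hnt => ?_
  have f1 : ∀ p q, p < q → q < n → Even p → Odd q → c p ∈ M → c q ∈ M → x ∈ M :=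
    fun p q hpq hq hp hqo h1 h2 => hM.mem_of_edge h1 h2 hxmem (hE p q hpq hq hp hqo)
  have f2 : ∀ p q, p < q → q < n → Even p → Odd q → x ∈ M → c p ∈ M → c q ∈ M :=
    fun p q hpq hq hp hqo h1 h2 => hM.mem_of_edge h1 h2 (hmem q hq)
      (T.rot (T.rot (hE p q hpq hq hp hqo)))
  have f3 : ∀ p q, p < q → q < n → Even p → Odd q → x ∈ M → c q ∈ M → c p ∈ M :=
    fun p q hpq hq hp hqo h1 h2 => hM.mem_of_edge h2 h1 (hmem p (by omega))
      (T.rot (hE p q hpq hq hp hqo))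
  obtain ⟨N, hN⟩ := hn
  have hlast : Odd (n - 1) := ⟨N - 1, by omega⟩
  have e0 : Even 0 := by decide
  have finish : ∀ p < n, x ∈ M → c p ∈ M → insert x {v | ∃ i < n, v = c i} ⊆ M := by
    intro p hp hxM hpM
    have hl : c (n - 1) ∈ M := by
      rcases Nat.even_or_odd p with hpe | hpo
      · obtain ⟨p', hp'⟩ := id hpe
        exact f2 p (n - 1) (by omega) (by omega) hpe hlast hxM hpM
      · obtain ⟨p', hp'⟩ := id hpo
        have := f3 0 p (by omega) hp e0 hpo hxM hpM
        exact f2 0 (n - 1) (by omega) (by omega) e0 hlast hxM this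
    have h0 := f3 0 (n - 1) (by omega) (by omega) e0 hlast hxM hl
    rintro w (hw | ⟨i, hi, rfl⟩)
    · rwa [hw]
    · rcases Nat.even_or_odd i with hie | hio
      · obtain ⟨i', hi'⟩ := id hie
        exact f3 i (n - 1) (by omega) (by omega) hie hlast hxM hl
      · obtain ⟨i', hi'⟩ := id hio
        exact f2 0 i (by omega) hi e0 hio hxM h0
  -- If `x ∉ M`, exchanging `c p` and `c q` in an edge formed by two consecutive positions and `x`
  -- yields an edge with `x` whose lower position is odd or whose upper position is even. Both are
  -- forbidden by `pair`.
  have main : ∀ p q, p < q → q < n → c p ∈ M → c q ∈ M → x ∈ M := by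
    intro p q hpq hq h1 h2
    by_contra hxM
    have no : ∀ i j, i < j → j < n → T.E (c i) (c j) x → Even i ∧ Odd j := fun i j hij hj e =>
      ⟨(h.pair hij hj hx e).2.1, (h.pair hij hj hx e).2.2.1⟩
    rcases Nat.even_or_odd p with hp | hp
    · rcases Nat.even_or_odd q with hq' | hq'
      · have hpq' : p + 1 < q := by
          obtain ⟨a, ha⟩ := hp; obtain ⟨b, hb⟩ := hq'; omega
        have hpM : c (p + 1) ∉ M := fun hh =>
          hxM (f1 p (p + 1) (by omega) (by omega) hp hp.add_one h1 hh)
        have e := (hM.2 _ h1 _ h2 _ (hmem (p + 1) (by omega)) hpM).2 x hxmem hxM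
          (hE p (p + 1) (by omega) (by omega) hp hp.add_one)
        exact Nat.not_even_iff_odd.2 hp.add_one (no (p + 1) q hpq' hq (T.swap e)).1
      · exact hxM (f1 p q hpq hq hp hq' h1 h2)
    · obtain ⟨p', hp'⟩ := id hp
      have hpe : Even (p - 1) := ⟨p', by omega⟩
      have e := hE (p - 1) p (by omega) (by omega) hpe hp
      have hpM : c (p - 1) ∉ M := fun hh => hxM (f1 (p - 1) p (by omega) (by omega) hpe hp hh h1)
      have e' := (hM.2 _ h1 _ h2 _ (hmem (p - 1) (by omega)) hpM).2 x hxmem hxM (T.swap e)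
      have hqo := (no (p - 1) q (by omega) hq (T.swap e')).2
      have hpq' : p < q - 1 := by
        obtain ⟨b, hb⟩ := hqo; omega
      obtain ⟨q', hq'⟩ := id hqo
      have hqe : Even (q - 1) := ⟨q', by omega⟩
      have hqM : c (q - 1) ∉ M := fun hh => hxM (f1 (q - 1) q (by omega) (by omega) hqe hqo hh h2)
      have e2 := (hM.2 _ h2 _ h1 _ (hmem (q - 1) (by omega)) hqM).2 x hxmem hxM
        (T.swap (hE (q - 1) q (by omega) (by omega) hqe hqo))
      exact Nat.not_even_iff_odd.2 hp (no p (q - 1) hpq' (by omega) e2).1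
  have main' : ∀ p q, p ≠ q → p < n → q < n → c p ∈ M → c q ∈ M → x ∈ M := by
    intro p q hne hp hq h1 h2
    rcases hne.lt_or_gt with hlt | hlt
    · exact main p q hlt hq h1 h2
    · exact main q p hlt hp h2 h1
  obtain ⟨m, hm, m', hm', hne'⟩ := hnt
  rcases hM.1 hm with rfl | ⟨p, hp, rfl⟩
  · rcases hM.1 hm' with rfl | ⟨q, hq, rfl⟩
    · exact absurd rfl hne'
    · exact finish q hq hm hm'
  · rcases hM.1 hm' with rfl | ⟨q, hq, rfl⟩
    · exact finish p hp hm' hm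
    · exact finish p hp (main' p q (by rintro rfl; exact hne' rfl) hp hq hm hm') hm

end IsStrand

/-! ### Closed strands: the cycle components. -/

/-- The periodic sequence `c` behaves like a cycle component of length `n` of the primality graph
of a critical system. -/
structure IsLoopStrand (T : TripleSystem V) (c : ℕ → V) (n : ℕ) : Prop where
  three_le : 3 ≤ n
  period : ∀ i, c (i + n) = c i
  inj : ∀ i < n, ∀ j < n, c i = c j → i = j
  step : ∀ i, ∀ x u, x ≠ c i → u ≠ c i → x ≠ c (i + 1) → u ≠ c (i + 1) →
    (T.E (c i) x u ↔ T.E (c (i + 2)) x u)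

namespace IsLoopStrand

variable {c : ℕ → V} {n i j k : ℕ} {x u : V}

lemma mod (h : T.IsLoopStrand c n) (i : ℕ) : c (i % n) = c i := by
  conv_rhs => rw [← Nat.mod_add_div i n]
  induction i / n with
  | zero => simp
  | succ k ih => rw [ih, Nat.mul_succ, ← add_assoc, h.period]

lemma ne (h : T.IsLoopStrand c n) (hij : i < j) (hj : j < i + n) : c i ≠ c j := by
  intro e
  have h3 := h.three_le
  rw [← h.mod i, ← h.mod j] at e
  have := h.inj _ (Nat.mod_lt _ (by omega)) _ (Nat.mod_lt _ (by omega)) e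
  have h1 : (j - i) % n = 0 := Nat.sub_mod_eq_zero_of_mod_eq this.symm
  rw [Nat.mod_eq_of_lt (by omega)] at h1
  omega

lemma slide (h : T.IsLoopStrand c n) (hij : i ≤ j) (hpar : Even (j - i))
    (hx : ∀ l, i ≤ l → l < j → x ≠ c l) (hu : ∀ l, i ≤ l → l < j → u ≠ c l) :
    T.E (c i) x u ↔ T.E (c j) x u := by
  obtain ⟨k, hk⟩ := hpar
  obtain rfl : j = i + 2 * k := by omega
  exact TripleSystem.slide k (fun l h1 h2 => h.step l) hx hu

lemma not_edge (h : T.IsLoopStrand c n) (hij : i < j) (hj : j < i + n) (hpar : Even (j - i))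
    (hx : ∀ l, i ≤ l → l < j → x ≠ c l) : ¬ T.E (c i) (c j) x := by
  rw [h.slide hij.le hpar (fun l h1 h2 => (h.ne h2 (by omega)).symm) hx]
  exact T.irrefl _ _

/-- Both arcs between the two vertices have even length, and `x` misses the interior of at least one
of them. -/
lemma not_edge_of_even (h : T.IsLoopStrand c n) (hn : Even n) (hij : i < j) (hj : j < i + n)
    (hpar : Even (j - i)) : ¬ T.E (c i) (c j) x := by
  by_cases hx : ∃ l, i ≤ l ∧ l < j ∧ x = c l
  · obtain ⟨l, hil, hlj, rfl⟩ := hx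
    have hp : Even (i + n - j) := by
      obtain ⟨a, ha⟩ := hn; obtain ⟨b, hb⟩ := hpar; exact ⟨a - b, by omega⟩
    have := h.not_edge (x := c l) hj (by omega) hp (fun l' h1 h2 => h.ne (by omega) (by omega))
    rw [h.period] at this
    exact fun hE => this (T.swap hE)
  · push Not at hx
    exact h.not_edge hij hj hpar fun l h1 h2 => hx l h1 h2

/-- A closed strand of a prime system has odd length. -/
lemma odd (h : T.IsLoopStrand c n) (hV : T.PrimeOn Set.univ) : Odd n := by
  by_contra hodd
  have hn := Nat.not_odd_iff_even.1 hodd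
  obtain ⟨N, hN⟩ := id hn
  have h3 := h.three_le
  have same : ∀ i j, i < n → j < n → Even (i + j) → ∀ x, ¬ T.E (c i) (c j) x := by
    rintro i j hi hj ⟨r, hr⟩ x
    rcases lt_trichotomy i j with hlt | rfl | hlt
    · exact h.not_edge_of_even hn hlt (by omega) ⟨r - i, by omega⟩
    · exact T.irrefl _ _
    · exact fun hE => h.not_edge_of_even hn hlt (by omega) ⟨r - j, by omega⟩ (T.swap hE)
  have hAmem : ∀ i, Even i → c i ∈ {v | ∃ i < n, Even i ∧ v = c i} := by
    intro i hi
    refine ⟨i % n, Nat.mod_lt _ (by omega), ?_, (h.mod i).symm⟩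
    rw [Nat.even_iff] at hi hn ⊢
    rw [Nat.mod_mod_of_dvd _ (Nat.dvd_of_mod_eq_zero hn)]
    exact hi
  -- The even positions will form a module. The obstacle is moving `c i` to `c (i + 2)` past another
  -- vertex of the edge, `c (i + 1)`. That vertex first travels around the cycle to `c (i + n - 1)`,
  -- then `c i` advances, and finally it returns by one more step.
  have key : ∀ i, Even i → ∀ x u, x ∉ {v | ∃ i < n, Even i ∧ v = c i} →
      u ∉ {v | ∃ i < n, Even i ∧ v = c i} → T.E (c i) (c (i + 1)) u →
      T.E (c (i + 2)) (c (i + 1)) u := by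
    intro i hi x u hx hu hE
    by_cases huC : ∃ l < n, u = c l
    · obtain ⟨l, hl, rfl⟩ := huC
      have hlo : Odd l := by
        by_contra ho
        exact hu (hAmem l (Nat.not_odd_iff_even.1 ho))
      refine absurd (T.rot hE) ?_
      rw [← h.mod (i + 1)]
      refine same _ _ (Nat.mod_lt _ (by omega)) hl ?_ _
      have : Odd ((i + 1) % n) := by
        have := hi.add_one
        rw [Nat.even_iff] at hn
        rw [Nat.odd_iff] at this ⊢
        rw [Nat.mod_mod_of_dvd _ (Nat.dvd_of_mod_eq_zero hn)]
        exact this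
      exact this.add_odd hlo
    · push Not at huC
      have huc : ∀ l, u ≠ c l := fun l => by
        rw [← h.mod l]; exact huC _ (Nat.mod_lt _ (by omega))
      rw [T.swap_iff, h.slide (i := i + 1) (j := i + n - 1) (by omega) ⟨N - 1, by omega⟩
        (fun l h1 h2 => h.ne (by omega) (by omega)) (fun l _ _ => huc l), T.swap_iff,
        ← h.period i, h.slide (i := i + n) (j := i + n + 2) (by omega) ⟨1, by omega⟩
        (fun l h1 h2 => h.ne (by omega) (by omega)) (fun l _ _ => huc l), T.swap_iff,
        h.slide (i := i + n - 1) (j := i + n + 1) (by omega) ⟨1, by omega⟩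
        (fun l h1 h2 => (h.ne (by omega) (by omega)).symm) (fun l _ _ => huc l),
        show i + n + 2 = i + 2 + n by omega, show i + n + 1 = i + 1 + n by omega, h.period,
        h.period, T.swap_iff] at hE
      exact hE
  have next : ∀ i, Even i → ∀ x u, x ∉ {v | ∃ i < n, Even i ∧ v = c i} →
      u ∉ {v | ∃ i < n, Even i ∧ v = c i} → T.E (c i) x u → T.E (c (i + 2)) x u := by
    intro i hi x u hx hu hE
    have hxi : x ≠ c i := by rintro rfl; exact hx (hAmem i hi)
    have hui : u ≠ c i := by rintro rfl; exact hu (hAmem i hi)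
    by_cases hx1 : x = c (i + 1)
    · subst hx1
      exact key i hi (c (i + 1)) u hx hu hE
    by_cases hu1 : u = c (i + 1)
    · subst hu1
      exact T.rot (T.swap (key i hi (c (i + 1)) x hu hx (T.swap (T.rot (T.rot hE)))))
    exact (h.step i x u hxi hui hx1 hu1).1 hE
  have many : ∀ k i, Even i → ∀ x u, x ∉ {v | ∃ i < n, Even i ∧ v = c i} →
      u ∉ {v | ∃ i < n, Even i ∧ v = c i} → T.E (c i) x u → T.E (c (i + 2 * k)) x u := by
    intro k
    induction k with
    | zero => intro i _ x u _ _ hE; exact hE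
    | succ k ih =>
      intro i hi x u hx hu hE
      exact next (i + 2 * k) (hi.add (even_two_mul k)) x u hx hu (ih i hi x u hx hu hE)
  have hM : T.IsMod Set.univ {v | ∃ i < n, Even i ∧ v = c i} := by
    refine ⟨Set.subset_univ _, ?_⟩
    rintro - ⟨i, hi, hie, rfl⟩ - ⟨j, hj, hje, rfl⟩ x - hx
    refine ⟨same i j hi hj (hie.add hje) x, fun u _ hu hE => ?_⟩
    obtain ⟨a, ha⟩ := id hie
    obtain ⟨b, hb⟩ := id hje
    -- The extra `N` is half a period count, `n = 2 * N`: it adds one full turn, so that `j + n` is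
    -- reached from `i` even when `j < i`.
    have := many (N + b - a) i hie x u hx hu hE
    rwa [show i + 2 * (N + b - a) = j + n by omega, h.period] at this
  rcases hV.2 _ hM with hs | hs
  · exact h.ne (i := 0) (j := 2) (by omega) (by omega)
      (hs (hAmem 0 (by decide)) (hAmem 2 (by decide)))
  · have : c 1 ∈ {v | ∃ i < n, Even i ∧ v = c i} := by rw [hs]; trivial
    obtain ⟨i, hi, hie, e⟩ := this
    have := h.inj 1 (by omega) i hi e
    subst this
    exact absurd hie (by decide)

/-- A closed strand of a prime system covers all the vertices. -/
lemma surj (h : T.IsLoopStrand c n) (hV : T.PrimeOn Set.univ) (v : V) : ∃ i < n, v = c i := by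
  have h3 := h.three_le
  obtain ⟨N, hN⟩ := h.odd hV
  have same : ∀ i j, i < j → j < n → ∀ x, (∀ l < n, x ≠ c l) → ¬ T.E (c i) (c j) x := by
    intro i j hij hj x hx
    have hxc : ∀ l, x ≠ c l := fun l => by
      rw [← h.mod l]; exact hx _ (Nat.mod_lt _ (by omega))
    -- Since `n` is odd, one of the two arcs between `c i` and `c j` has even length.
    rcases Nat.even_or_odd (j - i) with hp | ⟨r, hr⟩
    · exact h.not_edge hij (by omega) hp (fun l _ _ => hxc l)
    · have := h.not_edge (x := x) (i := j) (j := i + n) (by omega) (by omega)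
        ⟨N - r, by omega⟩ (fun l _ _ => hxc l)
      rw [h.period] at this
      exact fun hE => this (T.swap hE)
  have hM : T.IsMod Set.univ {v | ∃ i < n, v = c i} := by
    refine ⟨Set.subset_univ _, ?_⟩
    rintro - ⟨i, hi, rfl⟩ - ⟨j, hj, rfl⟩ x - hx
    have hx' : ∀ l < n, x ≠ c l := fun l hl e => hx ⟨l, hl, e⟩
    refine ⟨?_, fun u _ hu hE => ?_⟩
    · rcases lt_trichotomy i j with hlt | rfl | hlt
      · exact same i j hlt hj x hx'
      · exact T.irrefl _ _
      · exact fun hE => same j i hlt hi x hx' (T.swap hE)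
    · have hxc : ∀ l, x ≠ c l := fun l => by
        rw [← h.mod l]; exact hx' _ (Nat.mod_lt _ (by omega))
      have huc : ∀ l, u ≠ c l := fun l => by
        rw [← h.mod l]; exact fun e => hu ⟨_, Nat.mod_lt _ (by omega), e⟩
      -- With `n` odd, one of `j + n` and `j + 2n` has the parity of `i`, so each vertex slides to
      -- every other one.
      rcases Nat.even_or_odd (j + n - i) with ⟨r, hr⟩ | ⟨r, hr⟩
      · rw [← h.period j]
        exact (h.slide (by omega) ⟨r, by omega⟩ (fun l _ _ => hxc l) (fun l _ _ => huc l)).1 hE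
      · rw [← h.period j, ← h.period (j + n)]
        exact (h.slide (by omega) ⟨r + N + 1, by omega⟩ (fun l _ _ => hxc l)
          (fun l _ _ => huc l)).1 hE
  rcases hV.2 _ hM with hs | hs
  · exact absurd (hs ⟨0, by omega, rfl⟩ ⟨1, by omega, rfl⟩) (h.ne (by omega) (by omega))
  · have : v ∈ {v | ∃ i < n, v = c i} := by rw [hs]; trivial
    exact this

lemma edge_iff_base (h : T.IsLoopStrand c n) (hn : Odd n) (h5 : 5 ≤ n) (hij : i < j) (hjk : j < k)
    (hk : k < n) (hij' : Odd (j - i)) (hjk' : Odd (k - j)) :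
    T.E (c i) (c j) (c k) ↔ T.E (c 0) (c 1) (c 2) := by
  obtain ⟨N, hN⟩ := hn
  obtain ⟨a, ha⟩ := hij'
  obtain ⟨b, hb⟩ := hjk'
  rcases Nat.even_or_odd i with ⟨r, hr⟩ | ⟨r, hr⟩
  · rw [← h.slide (i := 0) (j := i) (by omega) ⟨r, by omega⟩
      (fun l _ _ => (h.ne (by omega) (by omega)).symm)
      (fun l _ _ => (h.ne (by omega) (by omega)).symm), T.swap_iff,
      ← h.slide (i := 1) (j := j) (by omega) ⟨a + r, by omega⟩
      (fun l _ _ => h.ne (by omega) (by omega))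
      (fun l _ _ => (h.ne (by omega) (by omega)).symm), T.swap_iff, ← T.rot_iff,
      ← h.slide (i := 2) (j := k) (by omega) ⟨a + r + b, by omega⟩
      (fun l _ _ => h.ne (by omega) (by omega))
      (fun l _ _ => h.ne (by omega) (by omega)), T.rot_iff]
  -- For odd `i` the descent stops at `1, 2, 3`; then `c 3` travels up to `c n = c 0`.
  · rw [← h.slide (i := 1) (j := i) (by omega) ⟨r, by omega⟩
      (fun l _ _ => (h.ne (by omega) (by omega)).symm)
      (fun l _ _ => (h.ne (by omega) (by omega)).symm), T.swap_iff,
      ← h.slide (i := 2) (j := j) (by omega) ⟨a + r, by omega⟩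
      (fun l _ _ => h.ne (by omega) (by omega))
      (fun l _ _ => (h.ne (by omega) (by omega)).symm), T.swap_iff, ← T.rot_iff,
      ← h.slide (i := 3) (j := k) (by omega) ⟨a + r + b, by omega⟩
      (fun l _ _ => h.ne (by omega) (by omega))
      (fun l _ _ => h.ne (by omega) (by omega)),
      h.slide (i := 3) (j := 0 + n) (by omega) ⟨N - 1, by omega⟩
      (fun l _ _ => h.ne (by omega) (by omega))
      (fun l _ _ => h.ne (by omega) (by omega)), h.period]

/-- The edges of a prime system carried by a closed strand. -/
lemma edge_iff (h : T.IsLoopStrand c n) (hV : T.PrimeOn Set.univ) (h5 : 5 ≤ n) (hij : i < j)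
    (hjk : j < k) (hk : k < n) :
    T.E (c i) (c j) (c k) ↔ Odd (j - i) ∧ Odd (k - j) := by
  have hn := h.odd hV
  have fwd : ∀ i j k, i < j → j < k → k < n → T.E (c i) (c j) (c k) →
      Odd (j - i) ∧ Odd (k - j) := by
    intro i j k hij hjk hk hE
    constructor
    · by_contra ho
      exact h.not_edge hij (by omega) (Nat.not_odd_iff_even.1 ho)
        (fun l _ _ => (h.ne (by omega) (by omega)).symm) hE
    · by_contra ho
      exact h.not_edge hjk (by omega) (Nat.not_odd_iff_even.1 ho)
        (fun l _ _ => h.ne (by omega) (by omega)) (T.rot hE)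
  refine ⟨fwd i j k hij hjk hk, fun ⟨h1, h2⟩ => ?_⟩
  rw [h.edge_iff_base hn h5 hij hjk hk h1 h2]
  obtain ⟨u, -, w, -, hu0, hw0, huw, hE⟩ := hV.exists_edge (Set.mem_univ (c 0))
  obtain ⟨p, hp, rfl⟩ := h.surj hV u
  obtain ⟨q, hq, rfl⟩ := h.surj hV w
  have hp0 : p ≠ 0 := by rintro rfl; exact hu0 rfl
  have hq0 : q ≠ 0 := by rintro rfl; exact hw0 rfl
  have hpq : p ≠ q := by rintro rfl; exact huw rfl
  rcases hpq.lt_or_gt with hlt | hlt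
  · obtain ⟨h1, h2⟩ := fwd 0 p q (by omega) hlt hq hE
    exact (h.edge_iff_base hn h5 (by omega) hlt hq h1 h2).1 hE
  · have hE' := T.swap (T.rot (T.rot hE))
    obtain ⟨h1, h2⟩ := fwd 0 q p (by omega) hlt hp hE'
    exact (h.edge_iff_base hn h5 (by omega) hlt hp h1 h2).1 hE'

end IsLoopStrand
end TripleSystem

/-! ### Components of finite graphs of maximum degree at most two. -/

namespace SimpleGraph

variable {V : Type*} {G : SimpleGraph V}

/-- In a finite graph of maximum degree at most two, every component is spanned by a path
`c 0, …, c (n - 1)`, and either this path is induced or it closes up to a cycle. -/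
lemma exists_path_or_cycle [Finite V]
    (hdeg : ∀ v y w z, G.Adj v y → G.Adj v w → y ≠ w → G.Adj v z → z = y ∨ z = w)
    (C : G.ConnectedComponent) :
    ∃ (n : ℕ) (c : ℕ → V), (∀ i < n, ∀ j < n, c i = c j → i = j) ∧
      (∀ i, i + 1 < n → G.Adj (c i) (c (i + 1))) ∧ (∀ v, v ∈ C.supp ↔ ∃ i < n, v = c i) ∧
      ((∀ i < n, ∀ j < n, i < j → G.Adj (c i) (c j) → j = i + 1) ∨
        3 ≤ n ∧ G.Adj (c (n - 1)) (c 0)) := by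
  classical
  let P : Set ℕ := {n | 0 < n ∧ ∃ c : ℕ → V, (∀ i < n, ∀ j < n, c i = c j → i = j) ∧
    (∀ i, i + 1 < n → G.Adj (c i) (c (i + 1))) ∧ ∀ i < n, c i ∈ C.supp}
  have hbdd : BddAbove P := by
    refine ⟨Nat.card V, ?_⟩
    rintro n ⟨-, c, hc, -⟩
    have := Nat.card_le_card_of_injective (fun i : Fin n => c i)
      (fun i j h => Fin.ext (hc i i.2 j j.2 h))
    simpa using this
  obtain ⟨v0, hv0⟩ := C.nonempty_supp
  have hne : P.Nonempty := ⟨1, one_pos, fun _ => v0, by intro i hi j hj _; omega,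
    by intro i hi; omega, fun _ _ => hv0⟩
  obtain ⟨n, ⟨hn, c, hinj, hadj, hsupp⟩, hmax⟩ := hbdd.exists_isGreatest_of_nonempty hne
  -- The path is longest possible. A neighbour off the path would extend it at an end, or be a third
  -- neighbour of an interior vertex.
  have hclosed : ∀ i < n, ∀ w, G.Adj (c i) w → ∃ j < n, w = c j := by
    intro i hi w hw
    by_contra! hout
    have hwC : w ∈ C.supp := C.mem_supp_of_adj_mem_supp (hsupp i hi) hw
    by_cases h0 : i = 0
    · subst h0
      have : n + 1 ∈ P := by
        refine ⟨by omega, fun k => if k = 0 then w else c (k - 1), ?_, ?_, ?_⟩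
        · intro k hk l hl h
          by_cases hk0 : k = 0 <;> by_cases hl0 : l = 0 <;> simp only [hk0, hl0, if_true, if_false] at h ⊢
          · exact absurd h (hout _ (by omega))
          · exact absurd h.symm (hout _ (by omega))
          · have := hinj _ (by omega) _ (by omega) h; omega
        · intro k hk
          by_cases hk0 : k = 0
          · simp only [hk0, if_true]; simpa using hw.symm
          · have := hadj (k - 1) (by omega)
            rw [show k - 1 + 1 = k by omega] at this
            simpa [hk0] using this
        · intro k hk
          by_cases hk0 : k = 0
          · simpa [hk0] using hwC
          · simpa [hk0] using hsupp (k - 1) (by omega)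
      have := hmax this
      omega
    by_cases h1 : i = n - 1
    · subst h1
      have : n + 1 ∈ P := by
        refine ⟨by omega, fun k => if k = n then w else c k, ?_, ?_, ?_⟩
        · intro k hk l hl h
          by_cases hk0 : k = n <;> by_cases hl0 : l = n <;> simp only [hk0, hl0, if_true, if_false] at h ⊢
          · exact absurd h (hout _ (by omega))
          · exact absurd h.symm (hout _ (by omega))
          · exact hinj _ (by omega) _ (by omega) h
        · intro k hk
          have hkn : k ≠ n := by omega
          by_cases hk0 : k + 1 = n
          · simp only [hk0, hkn, if_true, if_false]
            rwa [show k = n - 1 by omega]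
          · simpa [hk0, hkn] using hadj k (by omega)
        · intro k hk
          by_cases hk0 : k = n
          · simpa [hk0] using hwC
          · simpa [hk0] using hsupp k (by omega)
      have := hmax this
      omega
    have a1 := hadj (i - 1) (by omega)
    rw [show i - 1 + 1 = i by omega] at a1
    rcases hdeg _ _ _ _ a1.symm (hadj i (by omega))
      (fun e => by have := hinj _ (by omega) _ (by omega) e; omega) hw with e | e
    exacts [hout _ (by omega) e, hout _ (by omega) e]
  refine ⟨n, c, hinj, hadj, fun v => ⟨fun hv => ?_, ?_⟩, ?_⟩
  · have hreach : G.Reachable (c 0) v := by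
      have h0 := hsupp 0 hn
      rw [ConnectedComponent.mem_supp_iff] at hv h0
      exact ConnectedComponent.exact (h0.trans hv.symm)
    obtain ⟨p⟩ := hreach
    have : ∀ {a b : V}, G.Walk a b → (∃ i < n, a = c i) → ∃ i < n, b = c i := by
      intro a b p
      induction p with
      | nil => exact id
      | cons h _ ih =>
        rintro ⟨i, hi, rfl⟩
        exact ih (hclosed i hi _ h)
    exact this p ⟨0, hn, rfl⟩
  · rintro ⟨i, hi, rfl⟩; exact hsupp i hi
  -- An end of a chord that is interior to the path would have three neighbours, so the only
  -- possible chord joins the two ends.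
  · by_contra! hcon
    obtain ⟨⟨i, hi, j, hj, hij, ha, hne⟩, hcyc⟩ := hcon
    have hi0 : i = 0 := by
      by_contra h0
      have a1 := hadj (i - 1) (by omega)
      rw [show i - 1 + 1 = i by omega] at a1
      rcases hdeg _ _ _ _ a1.symm (hadj i (by omega))
        (fun e => by have := hinj _ (by omega) _ (by omega) e; omega) ha with e | e <;>
        · have := hinj _ (by omega) _ (by omega) e; omega
    have hjn : j = n - 1 := by
      by_contra h0
      have a1 := hadj (j - 1) (by omega)
      rw [show j - 1 + 1 = j by omega] at a1
      rcases hdeg _ _ _ _ a1.symm (hadj j (by omega))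
        (fun e => by have := hinj _ (by omega) _ (by omega) e; omega) ha.symm with e | e <;>
        · have := hinj _ (by omega) _ (by omega) e; omega
    subst hi0 hjn
    exact hcyc (by omega) ha.symm

/-- The sequence `c 0, …, c (n - 1)` enumerates the component `C` as an induced path. -/
structure ConnectedComponent.IsPathEnum (C : G.ConnectedComponent) (c : ℕ → V) (n : ℕ) :
    Prop where
  inj : ∀ i < n, ∀ j < n, c i = c j → i = j
  mem_supp : ∀ v, v ∈ C.supp ↔ ∃ i < n, v = c i
  adj : ∀ i < n, ∀ j < n, G.Adj (c i) (c j) ↔ i + 1 = j ∨ j + 1 = i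

lemma ConnectedComponent.IsPathEnum.order_eq {C : G.ConnectedComponent} {c : ℕ → V} {n : ℕ}
    (h : C.IsPathEnum c n) : C.order = n := by
  have : C.supp = Set.range (fun i : Fin n => c i) := by
    ext v
    rw [h.mem_supp]
    exact ⟨fun ⟨i, hi, e⟩ => ⟨⟨i, hi⟩, e.symm⟩, fun ⟨i, e⟩ => ⟨i, i.2, e.symm⟩⟩
  rw [ConnectedComponent.order, this, ← Set.image_univ, Set.ncard_image_of_injective _
    (fun i j e => Fin.ext (h.inj i i.2 j j.2 e))]
  simp

lemma ConnectedComponent.IsPathEnum.nonempty_iso {C : G.ConnectedComponent} {c : ℕ → V} {n : ℕ}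
    (h : C.IsPathEnum c n) : Nonempty (pathGraph C.order ≃g C.toSimpleGraph) := by
  rw [h.order_eq]
  refine ⟨⟨Equiv.ofBijective (fun i : Fin n => (⟨c i, (h.mem_supp _).2 ⟨i, i.2, rfl⟩⟩ : C.supp))
    ⟨fun i j e => Fin.ext (h.inj i i.2 j j.2 (congrArg Subtype.val e)), fun v => ?_⟩, ?_⟩⟩
  · obtain ⟨i, hi, e⟩ := (h.mem_supp v).1 v.2
    exact ⟨⟨i, hi⟩, Subtype.ext e.symm⟩
  · intro i j
    rw [pathGraph_adj]
    exact h.adj i i.2 j j.2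

/-- The sequence of vertices of the component `C` given by a path labelling. -/
noncomputable def PathLabelling.seq (φ : G.PathLabelling) (C : G.ConnectedComponent) (i : ℕ) : V :=
  -- The default beyond the order is immaterial: `IsPathEnum` and `IsStrand` only inspect smaller
  -- indices.
  if h : i < C.order then φ C ⟨i, h⟩ else Quot.out C

lemma PathLabelling.seq_val (φ : G.PathLabelling) (C : G.ConnectedComponent) (i : Fin C.order) :
    φ.seq C i = φ C i := by
  simp [PathLabelling.seq]

lemma PathLabelling.isPathEnum (φ : G.PathLabelling) (C : G.ConnectedComponent) :
    C.IsPathEnum (φ.seq C) C.order := by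
  refine ⟨fun i hi j hj e => ?_, fun v => ⟨fun hv => ?_, ?_⟩, fun i hi j hj => ?_⟩
  · have e' := (φ.seq_val C ⟨i, hi⟩).symm.trans (e.trans (φ.seq_val C ⟨j, hj⟩))
    have := (φ C).injective (Subtype.ext e')
    simpa using this
  · refine ⟨(φ C).symm ⟨v, hv⟩, ((φ C).symm ⟨v, hv⟩).2, ?_⟩
    rw [φ.seq_val]
    exact (congrArg Subtype.val ((φ C).apply_symm_apply ⟨v, hv⟩)).symm
  · rintro ⟨i, hi, rfl⟩
    rw [φ.seq_val C ⟨i, hi⟩]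
    exact (φ C ⟨i, hi⟩).2
  · rw [φ.seq_val C ⟨i, hi⟩, φ.seq_val C ⟨j, hj⟩]
    have := (φ C).map_adj_iff (v := ⟨i, hi⟩) (w := ⟨j, hj⟩)
    rw [pathGraph_adj] at this
    exact this

end SimpleGraph

/-! ### Components of the primality graph as strands. -/

namespace TripleSystem

open SimpleGraph

variable {V : Type*} {T : TripleSystem V}

/-- The vertices `c i` and `c (i + 2)` are the two neighbours of `c (i + 1)`, hence twins away from
it; the end conditions come from `leaf`. -/
lemma Critical.isStrand (hT : T.Critical) {C : T.primalityGraph.ConnectedComponent} {c : ℕ → V}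
    {n : ℕ} (h : C.IsPathEnum c n) : T.IsStrand c n := by
  have ends : ∀ i < n, ∀ j < n, T.primalityGraph.Adj (c i) (c j) →
      (∀ k < n, i + 1 = k ∨ k + 1 = i → k = j) →
      ∀ x u, T.E (c j) x u → x = c i ∨ u = c i := by
    intro i hi j hj ha hk x u hE
    refine hT.leaf ha (fun z hz => ?_) hE
    obtain ⟨k, hk', rfl⟩ := (h.mem_supp z).1
      (C.mem_supp_of_adj_mem_supp ((h.mem_supp _).2 ⟨i, hi, rfl⟩) hz)
    rw [hk k hk' ((h.adj i hi k hk').1 hz)]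
  refine ⟨h.inj, fun i hi x u hx hu hx' hu' => ?_, fun hn => ?_, fun hn => ?_⟩
  · refine hT.twins ((h.adj (i + 1) (by omega) i (by omega)).2 (by omega))
      ((h.adj (i + 1) (by omega) (i + 2) (by omega)).2 (by omega)) ?_ hx' hu' hx hu
    intro e
    have := h.inj _ (by omega) _ (by omega) e
    omega
  · exact ends 0 (by omega) 1 (by omega) ((h.adj _ (by omega) _ (by omega)).2 (by omega))
      (by omega)
  · exact ends (n - 1) (by omega) (n - 2) (by omega)
      ((h.adj _ (by omega) _ (by omega)).2 (by omega)) (by omega)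

/-- A component of the primality graph of a critical system is a path, unless the system is
carried by a closed strand. -/
lemma Critical.exists_isPathEnum [Finite V] (hT : T.Critical)
    (hno : ∀ c n, ¬ T.IsLoopStrand c n) (C : T.primalityGraph.ConnectedComponent) :
    ∃ c n, C.IsPathEnum c n := by
  obtain ⟨n, c, hinj, hadj, hsupp, hpath | ⟨h3, hcyc⟩⟩ :=
    exists_path_or_cycle (fun v y w z hy hw hne hz => hT.eq_or_eq_of_adj hy hw hne hz) C
  · refine ⟨c, n, hinj, hsupp, fun i hi j hj => ⟨fun ha => ?_, ?_⟩⟩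
    · rcases lt_trichotomy i j with hlt | rfl | hlt
      · exact .inl (hpath i hi j hj hlt ha).symm
      · exact absurd ha (T.primalityGraph.irrefl)
      · exact .inr (hpath j hj i hi hlt ha.symm).symm
    · rintro (rfl | rfl)
      · exact hadj i hj
      · exact (hadj j hi).symm
  · refine absurd ?_ (hno (fun i => c (i % n)) n)
    have hadj' : ∀ i, T.primalityGraph.Adj (c (i % n)) (c ((i + 1) % n)) := by
      intro i
      have hlt := Nat.mod_lt i (show 0 < n by omega)
      by_cases hi : i % n + 1 < n
      · rw [Nat.add_mod, Nat.mod_eq_of_lt (show 1 < n by omega), Nat.mod_eq_of_lt hi]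
        exact hadj _ hi
      · rw [Nat.add_mod, Nat.mod_eq_of_lt (show 1 < n by omega), show i % n + 1 = n by omega,
          Nat.mod_self, show i % n = n - 1 by omega]
        exact hcyc
    refine ⟨h3, fun i => by simp, fun i hi j hj e => ?_, fun i x u hx hu hx' hu' => ?_⟩
    · rw [Nat.mod_eq_of_lt hi, Nat.mod_eq_of_lt hj] at e
      exact hinj i hi j hj e
    · refine hT.twins (hadj' i).symm (hadj' (i + 1)) ?_ hx' hu' hx hu
      intro e
      have := hinj _ (Nat.mod_lt _ (by omega)) _ (Nat.mod_lt _ (by omega)) e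
      have h1 : (i + 1 + 1 - i) % n = 0 := Nat.sub_mod_eq_zero_of_mod_eq this.symm
      rw [show i + 1 + 1 - i = 2 by omega, Nat.mod_eq_of_lt (by omega)] at h1
      omega

end TripleSystem

/-! ### Translation between hypergraphs and triple systems. -/

open TripleSystem

namespace Hypergraph

variable {α : Type*} {H : Hypergraph α}

/-- The ternary edge relation of a `3`-hypergraph. -/
def triples (H : Hypergraph α) (hunif : H.IsUniform 3) : TripleSystem H.vertexSet where
  E a b c := ({(a : α), (b : α), (c : α)} : Set α) ∈ H.edgeSet
  swap h := by rwa [Set.insert_comm]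
  rot {a b c} h := by
    have : ({(b : α), (c : α), (a : α)} : Set α) = {(a : α), (b : α), (c : α)} := by
      ext; simp only [Set.mem_insert_iff, Set.mem_singleton_iff]; tauto
    rwa [this]
  irrefl a b h := by
    have h1 := hunif _ h
    rw [Set.insert_eq_of_mem (Set.mem_insert _ _)] at h1
    have := Set.ncard_insert_le (a : α) {(b : α)}
    rw [Set.ncard_singleton] at this
    omega

variable {hunif : H.IsUniform 3}

lemma exists_of_mem_edgeSet (hunif : H.IsUniform 3) {e : Set α} (he : e ∈ H.edgeSet) :
    ∃ a b c : H.vertexSet, a ≠ b ∧ a ≠ c ∧ b ≠ c ∧ e = {(a : α), (b : α), (c : α)} ∧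
      (H.triples hunif).E a b c := by
  obtain ⟨a, b, c, hab, hac, hbc, rfl⟩ := Set.ncard_eq_three.1 (hunif e he)
  have hsub := H.subset_vertexSet_of_mem_edgeSet' he
  exact ⟨⟨a, hsub (by simp)⟩, ⟨b, hsub (by simp)⟩, ⟨c, hsub (by simp)⟩,
    by simpa using hab, by simpa using hac, by simpa using hbc, rfl, he⟩

/-- For an edge crossing the boundary of `M`, the first clause of `IsMod` says that it has a single
vertex in `M`, and the second that this vertex can be exchanged. -/
lemma induce_isModule_iff (W : Set α) (M : Set H.vertexSet) :
    (H.induce W).IsModule (Subtype.val '' M) ↔ (H.triples hunif).IsMod {v | (v : α) ∈ W} M := by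
  constructor
  · rintro ⟨hsub, h⟩
    have hMW : ∀ m ∈ M, (m : α) ∈ W := fun m hm => (hsub ⟨m, hm, rfl⟩).2
    have hval : ∀ x : H.vertexSet, (x : α) ∈ Subtype.val '' M ↔ x ∈ M := by
      intro x; simp
    refine ⟨hMW, fun m hm n hn x hx hxM => ⟨fun hE => ?_, fun y hy hyM hE => ?_⟩⟩
    · obtain ⟨p, -, hp, -⟩ := h _ ⟨hE, by
        rintro u (rfl | rfl | rfl)
        exacts [hMW m hm, hMW n hn, hx]⟩ ⟨m, by simp, (hval m).2 hm⟩
        ⟨x, by simp, fun hh => hxM ((hval x).1 hh)⟩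
      have e1 : (m : α) ∈ ({p} : Set α) := hp ▸ ⟨by simp, (hval m).2 hm⟩
      have e2 : (n : α) ∈ ({p} : Set α) := hp ▸ ⟨by simp, (hval n).2 hn⟩
      have : m = n := Subtype.ext (e1.trans e2.symm)
      subst this
      exact (H.triples hunif).irrefl _ _ hE
    · obtain ⟨p, -, hp, hrep⟩ := h _ ⟨hE, by
        rintro u (rfl | rfl | rfl)
        exacts [hMW m hm, hx, hy]⟩ ⟨m, by simp, (hval m).2 hm⟩
        ⟨x, by simp, fun hh => hxM ((hval x).1 hh)⟩
      have e1 : (m : α) ∈ ({p} : Set α) := hp ▸ ⟨by simp, (hval m).2 hm⟩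
      obtain rfl : (m : α) = p := e1
      have := (hrep n ((hval n).2 hn)).1
      have hxm : (x : α) ≠ m := fun e => hxM (by rwa [Subtype.ext e])
      have hym : (y : α) ≠ m := fun e => hyM (by rwa [Subtype.ext e])
      have heq : (({(m : α), (x : α), (y : α)} : Set α) \ {(m : α)}) ∪ {(n : α)} =
          {(n : α), (x : α), (y : α)} := by
        ext u
        simp only [Set.mem_union, Set.mem_sdiff, Set.mem_insert_iff, Set.mem_singleton_iff]
        grind
      rw [heq] at this
      exact this
  · rintro ⟨hsub, h⟩
    refine ⟨?_, fun e he hne1 hne2 => ?_⟩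
    · rintro - ⟨m, hm, rfl⟩
      exact ⟨m.2, hsub hm⟩
    · obtain ⟨a, b, c, hab, hac, hbc, rfl, hE⟩ := exists_of_mem_edgeSet hunif he.1
      have hval : ∀ x : H.vertexSet, (x : α) ∈ Subtype.val '' M ↔ x ∈ M := by
        intro x; simp
      have heW : ∀ x : H.vertexSet, (x : α) ∈ ({(a : α), (b : α), (c : α)} : Set α) →
        x ∈ {v : H.vertexSet | (v : α) ∈ W} := fun x hx => he.2 hx
      -- The vertices of the edge are reordered so that the first lies in `M` and the second
      -- outside.
      obtain ⟨p, q, r, hpq, hpr, hqr, heq, hp, hq, hE'⟩ : ∃ p q r : H.vertexSet,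
          p ≠ q ∧ p ≠ r ∧ q ≠ r ∧
          ({(a : α), (b : α), (c : α)} : Set α) = {(p : α), (q : α), (r : α)} ∧
          p ∈ M ∧ q ∉ M ∧ (H.triples hunif).E p q r := by
        have s3 := @(H.triples hunif).rot
        have s4 := @(H.triples hunif).swap
        have p1 : ({(a : α), (b : α), (c : α)} : Set α) = {(b : α), (a : α), (c : α)} :=
          Set.insert_comm _ _ _
        have p2 : ({(a : α), (b : α), (c : α)} : Set α) = {(b : α), (c : α), (a : α)} := by
          ext; simp only [Set.mem_insert_iff, Set.mem_singleton_iff]; tauto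
        have p3 : ({(a : α), (b : α), (c : α)} : Set α) = {(c : α), (a : α), (b : α)} := by
          ext; simp only [Set.mem_insert_iff, Set.mem_singleton_iff]; tauto
        have p4 : ({(a : α), (b : α), (c : α)} : Set α) = {(a : α), (c : α), (b : α)} := by
          ext; simp only [Set.mem_insert_iff, Set.mem_singleton_iff]; tauto
        have p5 : ({(a : α), (b : α), (c : α)} : Set α) = {(c : α), (b : α), (a : α)} := by
          ext; simp only [Set.mem_insert_iff, Set.mem_singleton_iff]; tauto
        obtain ⟨u, hu | hu | hu, hu'⟩ := hne1 <;> obtain ⟨w, hw | hw | hw, hw'⟩ := hne2 <;>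
          rw [hu] at hu' <;> rw [hw] at hw' <;> rw [hval] at hu' hw'
        · exact absurd hu' hw'
        · exact ⟨a, b, c, hab, hac, hbc, rfl, hu', hw', hE⟩
        · exact ⟨a, c, b, hac, hab, hbc.symm, p4, hu', hw', s4 (s3 (s3 hE))⟩
        · exact ⟨b, a, c, hab.symm, hbc, hac, p1, hu', hw', s4 hE⟩
        · exact absurd hu' hw'
        · exact ⟨b, c, a, hbc, hab.symm, hac.symm, p2, hu', hw', s3 hE⟩
        · exact ⟨c, a, b, hac.symm, hbc.symm, hab, p3, hu', hw', s3 (s3 hE)⟩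
        · exact ⟨c, b, a, hbc.symm, hac.symm, hab.symm, p5, hu', hw', s4 (s3 hE)⟩
        · exact absurd hu' hw'
      rw [heq] at heW ⊢
      have hpW := heW p (by simp)
      have hqW := heW q (by simp)
      have hrW := heW r (by simp)
      have hr : r ∉ M := fun hr =>
        (h p hp r hr q hqW hq).1 ((H.triples hunif).swap
          ((H.triples hunif).rot ((H.triples hunif).rot hE')))
      refine ⟨p, ⟨p, hp, rfl⟩, ?_, ?_⟩
      · ext u
        simp only [Set.mem_inter_iff, Set.mem_insert_iff, Set.mem_singleton_iff]
        constructor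
        · rintro ⟨hu | hu | hu, hu'⟩
          · exact hu
          · rw [hu, hval] at hu'; exact absurd hu' hq
          · rw [hu, hval] at hu'; exact absurd hu' hr
        · rintro rfl; exact ⟨.inl rfl, (hval p).2 hp⟩
      · rintro - ⟨n, hn, rfl⟩
        have heq' : (({(p : α), (q : α), (r : α)} : Set α) \ {(p : α)}) ∪ {(n : α)} =
            {(n : α), (q : α), (r : α)} := by
          have h1 : (p : α) ≠ q := fun e => hpq (Subtype.ext e)
          have h2 : (p : α) ≠ r := fun e => hpr (Subtype.ext e)
          ext u
          simp only [Set.mem_union, Set.mem_sdiff, Set.mem_insert_iff, Set.mem_singleton_iff]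
          grind
        rw [heq']
        refine ⟨(h p hp n hn q hqW hq).2 r hrW hr hE', ?_⟩
        rintro u (rfl | rfl | rfl)
        exacts [hsub hn, hqW, hrW]

lemma induce_isPrime_iff (hfin : H.vertexSet.Finite) (W : Set α) :
    (H.induce W).IsPrime ↔ (H.triples hunif).PrimeOn {v | (v : α) ∈ W} := by
  have hvs : (H.induce W).vertexSet = Subtype.val '' {v : H.vertexSet | (v : α) ∈ W} := by
    ext u
    constructor
    · rintro ⟨h1, h2⟩; exact ⟨⟨u, h1⟩, h2, rfl⟩
    · rintro ⟨v, hv, rfl⟩; exact ⟨v.2, hv⟩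
  have hinj := Subtype.val_injective (p := (· ∈ H.vertexSet))
  have hcard : 3 ≤ (H.induce W).vertexSet.ncard ↔ ∃ a ∈ {v : H.vertexSet | (v : α) ∈ W},
      ∃ b ∈ {v : H.vertexSet | (v : α) ∈ W}, ∃ c ∈ {v : H.vertexSet | (v : α) ∈ W},
        a ≠ b ∧ a ≠ c ∧ b ≠ c := by
    have : Finite H.vertexSet := hfin
    rw [hvs, Set.ncard_image_of_injective _ hinj, ← Set.two_lt_ncard]
    rfl
  rw [IsPrime, PrimeOn, hcard, and_comm]
  refine and_congr_right fun _ => ?_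
  have htriv : ∀ M : Set H.vertexSet, M ⊆ {v : H.vertexSet | (v : α) ∈ W} →
      ((H.induce W).IsTrivialModule (Subtype.val '' M) ↔
        M.Subsingleton ∨ M = {v : H.vertexSet | (v : α) ∈ W}) := by
    intro M hM
    rw [IsTrivialModule, hvs, (Set.image_injective.2 hinj).eq_iff, Set.image_eq_empty]
    constructor
    · rintro (rfl | h | ⟨v, -, h⟩)
      · exact .inl Set.subsingleton_empty
      · exact .inr h
      · exact .inl (Set.subsingleton_of_image hinj _ (h ▸ Set.subsingleton_singleton))
    · rintro (h | h)
      · rcases h.eq_empty_or_singleton with rfl | ⟨v, rfl⟩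
        · exact .inl rfl
        · exact .inr (.inr ⟨v, ⟨v, hM rfl, rfl⟩, Set.image_singleton⟩)
      · exact .inr (.inl h)
  constructor
  · intro h M hM
    exact (htriv M hM.1).1 (h _ ((induce_isModule_iff W M).2 hM))
  · intro h M hM
    obtain ⟨M, rfl⟩ : ∃ M' : Set H.vertexSet, Subtype.val '' M' = M :=
      ⟨Subtype.val ⁻¹' M, by
        rw [Subtype.image_preimage_coe]
        exact Set.inter_eq_right.2 fun u hu => (hM.1 hu).1⟩
    have hM' := (induce_isModule_iff (hunif := hunif) W M).1 hM
    exact (htriv M hM'.1).2 (h M hM')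

lemma delete_isPrime_iff (hfin : H.vertexSet.Finite) (W : Set α) :
    (H.delete W).IsPrime ↔ (H.triples hunif).PrimeOn {v | (v : α) ∉ W} := by
  rw [delete, induce_isPrime_iff (hunif := hunif) hfin]
  have : {v : H.vertexSet | (v : α) ∈ H.vertexSet \ W} =
      {v : H.vertexSet | (v : α) ∉ W} := by
    ext v; simp
  rw [this]

lemma delete_empty : H.delete ∅ = H := by
  obtain ⟨V, E, h⟩ := H
  have hE : {e | e ∈ E ∧ e ⊆ V \ ∅} = E := by
    ext e
    simp only [Set.sdiff_empty, Set.mem_ofPred_eq]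
    exact ⟨fun h => h.1, fun he => ⟨he, h he⟩⟩
  simp only [delete, induce, Set.sdiff_empty, Set.inter_self] at hE ⊢
  simp only [hE]

/-- Decomposability of `H - v` is stronger than the failure of primality that `Critical` asks for.
-/
lemma IsCritical.triples (hfin : H.vertexSet.Finite) (hcrit : H.IsCritical) :
    (H.triples hunif).Critical := by
  constructor
  · have h := hcrit.1
    rw [← delete_empty (H := H), delete_isPrime_iff (hunif := hunif) hfin] at h
    convert h
    ext; simp
  · intro v hv
    refine hcrit.2 v v.2 ?_
    have : {w : H.vertexSet | (w : α) ∉ ({(v : α)} : Set α)} = {v}ᶜ := by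
      ext w; simp [Subtype.ext_iff]
    exact ((delete_isPrime_iff (hunif := hunif) hfin {(v : α)}).2 (by rwa [this])).1

lemma primalityGraph_eq (hfin : H.vertexSet.Finite) :
    H.primalityGraph = (H.triples hunif).primalityGraph := by
  ext v w
  have : {u : H.vertexSet | (u : α) ∉ ({(v : α), (w : α)} : Set α)} = {v, w}ᶜ := by
    ext u; simp [Subtype.ext_iff]
  change v ≠ w ∧ _ ↔ v ≠ w ∧ _
  rw [delete_isPrime_iff (hunif := hunif) hfin, this]

end Hypergraph

/-! ### The 3-cycles of the tournaments `U_m` and `T_m`. -/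

/-- The edges of the `C₃`-structure of an asymmetric digraph. -/
lemma Digraph.mem_cThree_edgeSet_iff {V : Type*} {D : Digraph V}
    (hD : ∀ a b, D.Adj a b → ¬ D.Adj b a) {X : Set V} :
    X ∈ D.cThree.edgeSet ↔ ∃ a b c, X = {a, b, c} ∧ D.Adj a b ∧ D.Adj b c ∧ D.Adj c a := by
  constructor
  · rintro ⟨f, hf⟩
    refine ⟨f 0, f 1, f 2, ?_, (hf 0 1).1 (by simp [threeCycle]), (hf 1 2).1 (by simp [threeCycle]),
      (hf 2 0).1 (by simp [threeCycle])⟩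
    ext x
    constructor
    · intro hx
      obtain ⟨i, hi⟩ := f.surjective ⟨x, hx⟩
      have : x = f i := by rw [hi]
      rw [this]
      fin_cases i <;> simp
    · rintro (rfl | rfl | rfl) <;> exact Subtype.coe_prop _
  · rintro ⟨a, b, c, rfl, hab, hbc, hca⟩
    have hirr : ∀ a, ¬ D.Adj a a := fun a h => hD a a h h
    have hne1 : a ≠ b := by rintro rfl; exact hirr _ hab
    have hne2 : b ≠ c := by rintro rfl; exact hirr _ hbc
    have hne3 : c ≠ a := by rintro rfl; exact hirr _ hca
    let g : Fin 3 → ({a, b, c} : Set V) := ![⟨a, by simp⟩, ⟨b, by simp⟩, ⟨c, by simp⟩]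
    have hg : Function.Bijective g := by
      constructor
      · intro i j hij
        have := congrArg Subtype.val hij
        fin_cases i <;> fin_cases j <;> simp_all [g]
      · rintro ⟨x, rfl | rfl | rfl⟩
        exacts [⟨0, rfl⟩, ⟨1, rfl⟩, ⟨2, rfl⟩]
    refine ⟨Equiv.ofBijective g hg, fun i j => ?_⟩
    have h1 := hD _ _ hab
    have h2 := hD _ _ hbc
    have h3 := hD _ _ hca
    fin_cases i <;> fin_cases j <;> simp [g, threeCycle, hirr, hab, hbc, hca, h1, h2, h3]

/-- Only arcs between even vertices go down. A 3-cycle has a downward arc, so its ends are even, and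
the third vertex must be odd and lie between them. -/
lemma mem_cThree_tournamentU_iff {n : ℕ} {X : Set (Fin n)} :
    X ∈ (tournamentU n).cThree.edgeSet ↔ ∃ i j k : Fin n, i < j ∧ j < k ∧
      Even i.val ∧ Odd j.val ∧ Even k.val ∧ X = {i, j, k} := by
  have hrot : ∀ a b c : Fin n, ({a, b, c} : Set (Fin n)) = {b, c, a} := by
    intro a b c; ext; simp only [Set.mem_insert_iff, Set.mem_singleton_iff]; tauto
  rw [Digraph.mem_cThree_edgeSet_iff]
  · constructor
    · rintro ⟨a, b, c, rfl, hab, hbc, hca⟩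
      simp only [tournamentU] at hab hbc hca
      by_cases ha : Even a.val <;> by_cases hb : Even b.val <;> by_cases hc : Even c.val <;>
        simp only [ha, hb, hc, and_true, and_false, not_true_eq_false, not_false_eq_true,
          or_false, false_or] at hab hbc hca
      · omega
      · exact ⟨b, c, a, hbc, hca, hb, Nat.not_even_iff_odd.1 hc, ha, hrot _ _ _⟩
      · exact ⟨a, b, c, hab, hbc, ha, Nat.not_even_iff_odd.1 hb, hc, rfl⟩
      · omega
      · exact ⟨c, a, b, hca, hab, hc, Nat.not_even_iff_odd.1 ha, hb, by rw [← hrot]⟩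
      · omega
      · omega
      · omega
    · rintro ⟨i, j, k, hij, hjk, hi, hj, hk, rfl⟩
      have hj' := Nat.not_even_iff_odd.2 hj
      exact ⟨i, j, k, rfl, .inl ⟨hij, fun h => hj' h.2⟩, .inl ⟨hjk, fun h => hj' h.1⟩,
        .inr ⟨hij.trans hjk, hk, hi⟩⟩
  · intro a b h1 h2
    simp only [tournamentU] at h1 h2
    grind

/-- On `i < j < k`, the parities rule out the cycle `i → j → k → i`; the cycle `k → j → i → k`
occurs exactly when both gaps are odd. -/
lemma mem_cThree_tournamentT_iff {n : ℕ} {X : Set (Fin n)} :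
    X ∈ (tournamentT n).cThree.edgeSet ↔ ∃ i j k : Fin n, i < j ∧ j < k ∧
      Odd (j.val - i.val) ∧ Odd (k.val - j.val) ∧ X = {i, j, k} := by
  have hrot : ∀ a b c : Fin n, ({a, b, c} : Set (Fin n)) = {b, c, a} := by
    intro a b c; ext; simp only [Set.mem_insert_iff, Set.mem_singleton_iff]; tauto
  have hrev : ∀ a b c : Fin n, ({a, b, c} : Set (Fin n)) = {c, b, a} := by
    intro a b c; ext; simp only [Set.mem_insert_iff, Set.mem_singleton_iff]; tauto
  rw [Digraph.mem_cThree_edgeSet_iff]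
  · constructor
    · rintro ⟨a, b, c, rfl, hab, hbc, hca⟩
      simp only [tournamentT, Fin.lt_def] at hab hbc hca
      have key : ∀ i j : Fin n, i < j → ¬ (Even i.val ↔ Even j.val) → Odd (j.val - i.val) := by
        intro i j hij h
        rw [Nat.odd_sub (by exact hij.le)]
        simp only [← Nat.not_even_iff_odd]
        tauto
      rcases hab with ⟨l1, e1⟩ | ⟨l1, e1⟩ <;> rcases hbc with ⟨l2, e2⟩ | ⟨l2, e2⟩ <;>
        rcases hca with ⟨l3, e3⟩ | ⟨l3, e3⟩
      · omega
      · tauto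
      · tauto
      · exact ⟨a, c, b, l3, l2, key _ _ l3 (by tauto), key _ _ l2 (by tauto), by
          rw [Set.pair_comm]⟩
      · tauto
      · exact ⟨b, a, c, l1, l3, key _ _ l1 (by tauto), key _ _ l3 (by tauto), by
          rw [Set.insert_comm]⟩
      · exact ⟨c, b, a, l2, l1, key _ _ l2 (by tauto), key _ _ l1 (by tauto), hrev _ _ _⟩
      · omega
    · rintro ⟨i, j, k, hij, hjk, h1, h2, rfl⟩
      rw [Nat.odd_sub hij.le, ← Nat.not_even_iff_odd] at h1
      rw [Nat.odd_sub hjk.le, ← Nat.not_even_iff_odd] at h2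
      refine ⟨k, j, i, hrev _ _ _, .inr ⟨hjk, by tauto⟩, .inr ⟨hij, by tauto⟩,
        .inl ⟨hij.trans hjk, by tauto⟩⟩
  · intro a b h1 h2
    simp only [tournamentT] at h1 h2
    grind

/-! ### Reconstruction of the edges from the primality graph, and nondegeneracy. -/

namespace TripleSystem

open SimpleGraph

variable {V : Type*} {T : TripleSystem V}

lemma exists_sorted {c : ℕ → V} {n i j k : ℕ} (hi : i < n) (hj : j < n) (hk : k < n)
    (hE : T.E (c i) (c j) (c k)) :
    ∃ p q r, p < q ∧ q < r ∧ r < n ∧ T.E (c p) (c q) (c r) ∧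
      ({c i, c j, c k} : Set V) = {c p, c q, c r} := by
  have p1 : ({c i, c j, c k} : Set V) = {c j, c i, c k} := Set.insert_comm _ _ _
  have p2 : ({c i, c j, c k} : Set V) = {c j, c k, c i} := by
    ext; simp only [Set.mem_insert_iff, Set.mem_singleton_iff]; tauto
  have p3 : ({c i, c j, c k} : Set V) = {c k, c i, c j} := by
    ext; simp only [Set.mem_insert_iff, Set.mem_singleton_iff]; tauto
  have p4 : ({c i, c j, c k} : Set V) = {c i, c k, c j} := by
    ext; simp only [Set.mem_insert_iff, Set.mem_singleton_iff]; tauto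
  have p5 : ({c i, c j, c k} : Set V) = {c k, c j, c i} := by
    ext; simp only [Set.mem_insert_iff, Set.mem_singleton_iff]; tauto
  have hij : i ≠ j := by rintro rfl; exact T.irrefl _ _ hE
  have hjk : j ≠ k := by rintro rfl; exact T.irrefl _ _ (T.rot hE)
  have hik : i ≠ k := by rintro rfl; exact T.irrefl _ _ (T.rot (T.rot hE))
  rcases hij.lt_or_gt with h1 | h1 <;> rcases hjk.lt_or_gt with h2 | h2 <;>
    rcases hik.lt_or_gt with h3 | h3
  · exact ⟨i, j, k, h1, h2, hk, hE, rfl⟩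
  · omega
  · exact ⟨i, k, j, h3, h2, hj, T.swap (T.rot (T.rot hE)), p4⟩
  · exact ⟨k, i, j, h3, h1, hj, T.rot (T.rot hE), p3⟩
  · exact ⟨j, i, k, h1, h3, hk, T.swap hE, p1⟩
  · exact ⟨j, k, i, h2, h3, hi, T.rot hE, p2⟩
  · omega
  · exact ⟨k, j, i, h2, h1, hi, T.swap (T.rot hE), p5⟩

/-- The `{2,3}`-hypergraph on the components of the primality graph whose edges are the sets of
components met by an edge, when there are at least two of them. -/
def componentHypergraph (T : TripleSystem V) :
    Hypergraph T.primalityGraph.ConnectedComponent where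
  vertexSet := Set.univ
  edgeSet := {ε | (ε.ncard = 2 ∨ ε.ncard = 3) ∧ ∃ a b d, T.E a b d ∧
    ε = {T.primalityGraph.connectedComponentMk a, T.primalityGraph.connectedComponentMk b,
      T.primalityGraph.connectedComponentMk d}}
  subset_vertexSet_of_mem_edgeSet' := fun _ _ => Set.subset_univ _

namespace Critical

variable (hT : T.Critical) (φ : T.primalityGraph.PathLabelling)
  {C D I J K : T.primalityGraph.ConnectedComponent} {a b d : V}
include hT φ

/-- Edges contained in a component. -/
lemma edge_inside (ha : T.primalityGraph.connectedComponentMk a = C)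
    (hb : T.primalityGraph.connectedComponentMk b = C)
    (hd : T.primalityGraph.connectedComponentMk d = C) (hE : T.E a b d) :
    Odd C.order ∧ ∃ p q r, p < q ∧ q < r ∧ r < C.order ∧ Even p ∧ Odd q ∧ Even r ∧
      ({a, b, d} : Set V) = {φ.seq C p, φ.seq C q, φ.seq C r} := by
  have hP := φ.isPathEnum C
  have hs := hT.isStrand hP
  obtain ⟨i, hi, rfl⟩ := (hP.mem_supp a).1 ha
  obtain ⟨j, hj, rfl⟩ := (hP.mem_supp b).1 hb
  obtain ⟨k, hk, rfl⟩ := (hP.mem_supp d).1 hd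
  obtain ⟨p, q, r, hpq, hqr, hr, hE', heq⟩ := exists_sorted hi hj hk hE
  obtain ⟨h1, h2, h3, h4, -⟩ := hs.triple hpq hqr hr hE'
  exact ⟨h1, p, q, r, hpq, hqr, hr, h2, h3, h4, heq⟩

/-- Edges meeting two components. -/
lemma edge_two (hCD : C ≠ D) (ha : T.primalityGraph.connectedComponentMk a = C)
    (hb : T.primalityGraph.connectedComponentMk b = C)
    (hd : T.primalityGraph.connectedComponentMk d = D) (hE : T.E a b d) :
    Even C.order ∧ Odd D.order ∧
      (∀ p q r, p < q → q < C.order → r < D.order → Even p → Odd q → Even r →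
        T.E (φ.seq C p) (φ.seq C q) (φ.seq D r)) ∧
      ∃ p q r, p < q ∧ q < C.order ∧ r < D.order ∧ Even p ∧ Odd q ∧ Even r ∧
        ({a, b, d} : Set V) = {φ.seq C p, φ.seq C q, φ.seq D r} := by
  have hC := φ.isPathEnum C
  have hD := φ.isPathEnum D
  have key : ∀ i j k, i < j → j < C.order → k < D.order →
      T.E (φ.seq C i) (φ.seq C j) (φ.seq D k) → Even C.order ∧ Odd D.order ∧
      (∀ p q r, p < q → q < C.order → r < D.order → Even p → Odd q → Even r →
        T.E (φ.seq C p) (φ.seq C q) (φ.seq D r)) ∧ Even i ∧ Odd j ∧ Even k := by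
    intro i j k hij hj hk hE
    have hout : ∀ r < D.order, ∀ l < C.order, φ.seq D r ≠ φ.seq C l := by
      intro r hr l hl e
      have h1 := (hD.mem_supp _).2 ⟨r, hr, rfl⟩
      have h2 := (hC.mem_supp _).2 ⟨l, hl, e⟩
      exact hCD (h2.symm.trans h1)
    have hout' : ∀ l < C.order, ∀ r < D.order, φ.seq C l ≠ φ.seq D r :=
      fun l hl r hr e => hout r hr l hl e.symm
    -- The edge has two vertices on the strand `C` and one on the strand `D`: `pair` spreads it
    -- along `C` and `single` along `D`.
    obtain ⟨h1, h2, h3, h4⟩ := (hT.isStrand hC).pair hij hj (hout k hk) hE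
    obtain ⟨h5, h6, -⟩ := (hT.isStrand hD).single hk (hout' i (by omega)) (hout' j hj)
      (T.rot (T.rot hE))
    refine ⟨h1, h5, fun p q r hpq hq hr hp hq' hr' => ?_, h2, h3, h6⟩
    exact T.rot (((hT.isStrand hD).single hk (hout' p (by omega)) (hout' q hq)
      (T.rot (T.rot (h4 p q hpq hq hp hq')))).2.2 r hr hr')
  obtain ⟨i, hi, rfl⟩ := (hC.mem_supp a).1 ha
  obtain ⟨j, hj, rfl⟩ := (hC.mem_supp b).1 hb
  obtain ⟨k, hk, rfl⟩ := (hD.mem_supp d).1 hd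
  have hij : i ≠ j := by rintro rfl; exact T.irrefl _ _ hE
  rcases hij.lt_or_gt with hlt | hlt
  · obtain ⟨h1, h2, h3, h4, h5, h6⟩ := key i j k hlt hj hk hE
    exact ⟨h1, h2, h3, i, j, k, hlt, hj, hk, h4, h5, h6, rfl⟩
  · obtain ⟨h1, h2, h3, h4, h5, h6⟩ := key j i k hlt hi hk (T.swap hE)
    exact ⟨h1, h2, h3, j, i, k, hlt, hi, hk, h4, h5, h6, Set.insert_comm _ _ _⟩

/-- Edges meeting three components. -/
lemma edge_three (hIJ : I ≠ J) (hIK : I ≠ K) (hJK : J ≠ K)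
    (ha : T.primalityGraph.connectedComponentMk a = I)
    (hb : T.primalityGraph.connectedComponentMk b = J)
    (hd : T.primalityGraph.connectedComponentMk d = K) (hE : T.E a b d) :
    Odd I.order ∧ Odd J.order ∧ Odd K.order ∧
      (∀ p q r, p < I.order → q < J.order → r < K.order → Even p → Even q → Even r →
        T.E (φ.seq I p) (φ.seq J q) (φ.seq K r)) ∧
      ∃ p q r, p < I.order ∧ q < J.order ∧ r < K.order ∧ Even p ∧ Even q ∧ Even r ∧
        ({a, b, d} : Set V) = {φ.seq I p, φ.seq J q, φ.seq K r} := by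
  have hout : ∀ {C D : T.primalityGraph.ConnectedComponent}, C ≠ D →
      ∀ r < D.order, ∀ l < C.order, φ.seq D r ≠ φ.seq C l := by
    intro C D hCD r hr l hl e
    have h1 := ((φ.isPathEnum D).mem_supp _).2 ⟨r, hr, rfl⟩
    have h2 := ((φ.isPathEnum C).mem_supp _).2 ⟨l, hl, e⟩
    exact hCD (h2.symm.trans h1)
  obtain ⟨i, hi, rfl⟩ := ((φ.isPathEnum I).mem_supp a).1 ha
  obtain ⟨j, hj, rfl⟩ := ((φ.isPathEnum J).mem_supp b).1 hb
  obtain ⟨k, hk, rfl⟩ := ((φ.isPathEnum K).mem_supp d).1 hd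
  have hI := hT.isStrand (φ.isPathEnum I)
  have hJ := hT.isStrand (φ.isPathEnum J)
  have hK := hT.isStrand (φ.isPathEnum K)
  obtain ⟨i1, i2, i3⟩ := hI.single hi (hout hIJ j hj) (hout hIK k hk) hE
  obtain ⟨j1, j2, -⟩ := hJ.single hj (hout hJK k hk) (hout hIJ.symm i hi) (T.rot hE)
  obtain ⟨k1, k2, -⟩ := hK.single hk (hout hIK.symm i hi) (hout hJK.symm j hj) (T.rot (T.rot hE))
  refine ⟨i1, j1, k1, fun p q r hp hq hr hp' hq' hr' => ?_, i, j, k, hi, hj, hk, i2, j2, k2, rfl⟩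
  have e1 := i3 p hp hp'
  have e2 := (hJ.single hj (hout hJK k hk) (hout hIJ.symm p hp) (T.rot e1)).2.2 q hq hq'
  exact T.rot ((hK.single hk (hout hIK.symm p hp) (hout hJK.symm q hq) (T.rot e2)).2.2 r hr hr')

lemma parityConditions : T.primalityGraph.ParityConditions T.componentHypergraph := by
  constructor
  · rintro ε ⟨-, a, b, d, hE, rfl⟩ h2
    have aux : ∀ a b d, T.E a b d →
        T.primalityGraph.connectedComponentMk a = T.primalityGraph.connectedComponentMk b →
        T.primalityGraph.connectedComponentMk a ≠ T.primalityGraph.connectedComponentMk d →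
        Even (T.primalityGraph.connectedComponentMk a).order ∧
          Odd (T.primalityGraph.connectedComponentMk d).order := by
      intro a b d hE hab had
      have := hT.edge_two φ had rfl hab.symm rfl hE
      exact ⟨this.1, this.2.1⟩
    by_cases hab : T.primalityGraph.connectedComponentMk a =
        T.primalityGraph.connectedComponentMk b
    · by_cases had : T.primalityGraph.connectedComponentMk a =
          T.primalityGraph.connectedComponentMk d
      · rw [← hab, ← had] at h2
        simp at h2
      · obtain ⟨h, h'⟩ := aux a b d hE hab had
        exact ⟨⟨_, by simp, h⟩, ⟨_, by simp, h'⟩⟩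
    · by_cases had : T.primalityGraph.connectedComponentMk a =
          T.primalityGraph.connectedComponentMk d
      · obtain ⟨h, h'⟩ := aux a d b (T.swap (T.rot (T.rot hE))) had hab
        exact ⟨⟨_, by simp, h⟩, ⟨_, by simp, h'⟩⟩
      · by_cases hbd : T.primalityGraph.connectedComponentMk b =
          T.primalityGraph.connectedComponentMk d
        · obtain ⟨h, h'⟩ := aux b d a (T.rot hE) hbd (Ne.symm hab)
          exact ⟨⟨_, by simp, h⟩, ⟨_, by simp, h'⟩⟩
        · have := Set.ncard_eq_three.2 ⟨_, _, _, hab, had, hbd, rfl⟩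
          omega
  · rintro ε ⟨-, a, b, d, hE, rfl⟩ h3
    have hlt : ∀ x y : T.primalityGraph.ConnectedComponent,
        ({x, y} : Set T.primalityGraph.ConnectedComponent).ncard ≤ 2 :=
      fun x y => (Set.ncard_insert_le x {y}).trans (by rw [Set.ncard_singleton])
    have hab : T.primalityGraph.connectedComponentMk a ≠
        T.primalityGraph.connectedComponentMk b := by
      intro h
      rw [h, Set.insert_eq_of_mem (by simp)] at h3
      have := hlt (T.primalityGraph.connectedComponentMk b)
        (T.primalityGraph.connectedComponentMk d)
      omega
    have had : T.primalityGraph.connectedComponentMk a ≠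
        T.primalityGraph.connectedComponentMk d := by
      intro h
      rw [h, Set.insert_eq_of_mem (by simp)] at h3
      have := hlt (T.primalityGraph.connectedComponentMk b)
        (T.primalityGraph.connectedComponentMk d)
      omega
    have hbd : T.primalityGraph.connectedComponentMk b ≠
        T.primalityGraph.connectedComponentMk d := by
      intro h
      rw [h, Set.pair_eq_singleton] at h3
      have := hlt (T.primalityGraph.connectedComponentMk a)
        (T.primalityGraph.connectedComponentMk d)
      omega
    obtain ⟨h1, h2, h3, -⟩ := hT.edge_three φ hab had hbd rfl rfl rfl hE
    rintro C (rfl | rfl | rfl)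
    exacts [h1, h2, h3]

/-- The edges of a critical system are those of the hypergraph built from its primality graph. -/
lemma mem_bullet_iff {e : Set V} :
    e ∈ (T.primalityGraph.bullet T.componentHypergraph φ).edgeSet ↔
      ∃ a b d, T.E a b d ∧ e = {a, b, d} := by
  constructor
  · rintro ((⟨C, hodd, hne, X, hX, rfl⟩ | ⟨C, D, hC, hD, ⟨-, a, b, d, hE, heq⟩, hmem⟩) |
      ⟨I, J, K, -, -, -, hIJ, hIK, hJK, ⟨-, a, b, d, hE, heq⟩, hmem⟩)
    · rw [mem_cThree_tournamentU_iff] at hX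
      obtain ⟨i, j, k, hij, hjk, hi, hj, hk, rfl⟩ := hX
      refine ⟨φ C i, φ C j, φ C k, ?_, by simp [Set.image_insert_eq]⟩
      rw [← φ.seq_val, ← φ.seq_val, ← φ.seq_val]
      have hk' := k.2
      have h3 : 3 ≤ C.order := by
        have : i.val < j.val := hij
        have : j.val < k.val := hjk
        omega
      exact (hT.isStrand (φ.isPathEnum C)).edges_of_odd hT.1 hodd h3 hij hjk hk' hi hj hk
    · have hCD : C ≠ D := by
        rintro rfl
        exact Nat.not_odd_iff_even.2 hC hD
      have hall : ∀ p q r, p < q → q < C.order → r < D.order → Even p → Odd q → Even r →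
          T.E (φ.seq C p) (φ.seq C q) (φ.seq D r) := by
        have good : ∀ a b d, T.primalityGraph.connectedComponentMk a = C →
            T.primalityGraph.connectedComponentMk b = C →
            T.primalityGraph.connectedComponentMk d = D → T.E a b d → _ :=
          fun a b d h1 h2 h3 h => (hT.edge_two φ hCD h1 h2 h3 h).2.2.1
        -- The edge witnessing `{C, D}` cannot have two vertices in `D`, since `D` would then be
        -- even.
        have bad : ∀ a b d, T.primalityGraph.connectedComponentMk a = D →
            T.primalityGraph.connectedComponentMk b = D →
            T.primalityGraph.connectedComponentMk d = C → T.E a b d → False :=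
          fun a b d h1 h2 h3 h =>
            Nat.not_odd_iff_even.2 (hT.edge_two φ hCD.symm h1 h2 h3 h).1 hD
        have ha : T.primalityGraph.connectedComponentMk a ∈ ({C, D} : Set _) := by
          rw [heq]; simp
        have hb : T.primalityGraph.connectedComponentMk b ∈ ({C, D} : Set _) := by
          rw [heq]; simp
        have hd : T.primalityGraph.connectedComponentMk d ∈ ({C, D} : Set _) := by
          rw [heq]; simp
        have hC' : C ∈ ({C, D} : Set _) := by simp
        have hD' : D ∈ ({C, D} : Set _) := by simp
        rw [heq] at hC' hD'
        rcases ha with ha | ha <;> rcases hb with hb | hb <;> rcases hd with hd | hd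
        · rw [ha, hb, hd] at hD'; simp [hCD.symm] at hD'
        · exact good a b d ha hb hd hE
        · exact good a d b ha hd hb (T.swap (T.rot (T.rot hE)))
        · exact (bad b d a hb hd ha (T.rot hE)).elim
        · exact good b d a hb hd ha (T.rot hE)
        · exact (bad a d b ha hd hb (T.swap (T.rot (T.rot hE)))).elim
        · exact (bad a b d ha hb hd hE).elim
        · rw [ha, hb, hd] at hC'; simp [hCD] at hC'
      obtain ⟨x, y, z, i, j, k, hx, hy, hz, hij, rfl⟩ := hmem
      refine ⟨φ C x, φ C y, φ D z, ?_, rfl⟩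
      rw [← φ.seq_val, ← φ.seq_val, ← φ.seq_val]
      exact hall x y z (by omega) y.2 z.2 ⟨i, by omega⟩ ⟨j, by omega⟩ ⟨k, by omega⟩
    · have hall : ∀ p q r, p < I.order → q < J.order → r < K.order → Even p → Even q → Even r →
          T.E (φ.seq I p) (φ.seq J q) (φ.seq K r) := by
        have good : ∀ a b d, T.primalityGraph.connectedComponentMk a = I →
            T.primalityGraph.connectedComponentMk b = J →
            T.primalityGraph.connectedComponentMk d = K → T.E a b d → _ :=
          fun a b d h1 h2 h3 h => (hT.edge_three φ hIJ hIK hJK h1 h2 h3 h).2.2.2.1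
        have hI' : I ∈ ({I, J, K} : Set _) := by simp
        have hJ' : J ∈ ({I, J, K} : Set _) := by simp
        have hK' : K ∈ ({I, J, K} : Set _) := by simp
        rw [heq] at hI' hJ' hK'
        simp only [Set.mem_insert_iff, Set.mem_singleton_iff] at hI' hJ' hK'
        rcases hI' with h1 | h1 | h1 <;> rcases hJ' with h2 | h2 | h2 <;>
          rcases hK' with h3 | h3 | h3 <;>
          first
          | exact absurd (h1.trans h2.symm) hIJ
          | exact absurd (h1.trans h3.symm) hIK
          | exact absurd (h2.trans h3.symm) hJK
          | exact good _ _ _ h1.symm h2.symm h3.symm hE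
          | exact good _ _ _ h1.symm h2.symm h3.symm (T.swap hE)
          | exact good _ _ _ h1.symm h2.symm h3.symm (T.rot hE)
          | exact good _ _ _ h1.symm h2.symm h3.symm (T.rot (T.rot hE))
          | exact good _ _ _ h1.symm h2.symm h3.symm (T.swap (T.rot hE))
          | exact good _ _ _ h1.symm h2.symm h3.symm (T.swap (T.rot (T.rot hE)))
      obtain ⟨x, y, z, i, j, k, hx, hy, hz, rfl⟩ := hmem
      refine ⟨φ I x, φ J y, φ K z, ?_, rfl⟩
      rw [← φ.seq_val, ← φ.seq_val, ← φ.seq_val]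
      exact hall x y z x.2 y.2 z.2 ⟨i, by omega⟩ ⟨j, by omega⟩ ⟨k, by omega⟩
  · rintro ⟨a, b, d, hE, rfl⟩
    have two : ∀ a b d, T.E a b d →
        T.primalityGraph.connectedComponentMk a = T.primalityGraph.connectedComponentMk b →
        T.primalityGraph.connectedComponentMk a ≠ T.primalityGraph.connectedComponentMk d →
        ({a, b, d} : Set V) ∈
          (T.primalityGraph.bullet T.componentHypergraph φ).edgeSet := by
      intro a b d hE hab had
      obtain ⟨hC, hD, -, p, q, r, hpq, hq, hr, ⟨p', hp⟩, ⟨q', hq'⟩, ⟨r', hr'⟩, heq⟩ :=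
        hT.edge_two φ had rfl hab.symm rfl hE
      refine .inl (.inr ⟨_, _, hC, hD, ⟨.inl (Set.ncard_pair had), a, b, d, hE, ?_⟩, ?_⟩)
      · rw [← hab, Set.insert_eq_of_mem (Set.mem_insert _ _)]
      · refine ⟨⟨p, hpq.trans hq⟩, ⟨q, hq⟩, ⟨r, hr⟩, p', q', r', by simp only; omega,
          by simp only; omega, by simp only; omega, by omega, ?_⟩
        rw [heq, ← φ.seq_val, ← φ.seq_val, ← φ.seq_val]
    by_cases hab : T.primalityGraph.connectedComponentMk a =
        T.primalityGraph.connectedComponentMk b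
    · by_cases had : T.primalityGraph.connectedComponentMk a =
          T.primalityGraph.connectedComponentMk d
      · obtain ⟨hC, p, q, r, hpq, hqr, hr, hp, hq, hr', heq⟩ :=
          hT.edge_inside φ rfl hab.symm had.symm hE
        refine .inl (.inl ⟨_, hC, by omega, {⟨p, by omega⟩, ⟨q, by omega⟩, ⟨r, hr⟩}, ?_, ?_⟩)
        · rw [mem_cThree_tournamentU_iff]
          exact ⟨_, _, _, hpq, hqr, hp, hq, hr', rfl⟩
        · rw [heq, Set.image_insert_eq, Set.image_pair, ← φ.seq_val, ← φ.seq_val, ← φ.seq_val]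
      · exact two a b d hE hab had
    · by_cases had : T.primalityGraph.connectedComponentMk a =
          T.primalityGraph.connectedComponentMk d
      · rw [Set.pair_comm]
        exact two a d b (T.swap (T.rot (T.rot hE))) had hab
      · by_cases hbd : T.primalityGraph.connectedComponentMk b =
          T.primalityGraph.connectedComponentMk d
        · rw [Set.insert_comm, Set.pair_comm]
          exact two b d a (T.rot hE) hbd (Ne.symm hab)
        · obtain ⟨h1, h2, h3, -, p, q, r, hp, hq, hr, ⟨p', hp'⟩, ⟨q', hq'⟩, ⟨r', hr'⟩, heq⟩ :=
            hT.edge_three φ hab had hbd rfl rfl rfl hE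
          refine .inr ⟨_, _, _, h1, h2, h3, hab, had, hbd, ⟨.inr ?_, a, b, d, hE, rfl⟩, ?_⟩
          · exact Set.ncard_eq_three.2 ⟨_, _, _, hab, had, hbd, rfl⟩
          · refine ⟨⟨p, hp⟩, ⟨q, hq⟩, ⟨r, hr⟩, p', q', r', by simp only; omega,
              by simp only; omega, by simp only; omega, ?_⟩
            rw [heq, ← φ.seq_val, ← φ.seq_val, ← φ.seq_val]

/-- An adjacent pair outside a proper prime set `X` lies in a nontrivial component not contained in
`X`. Each clause applies this to a suitable `X`. -/
lemma isNondegenerate [Finite V] (h4 : 4 ≤ Nat.card V) : T.primalityGraph.IsNondegenerate := by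
  have outside : ∀ X, T.PrimeOn X → X ≠ Set.univ → ∃ D : T.primalityGraph.ConnectedComponent,
      D.order ≠ 1 ∧ ∀ C : T.primalityGraph.ConnectedComponent, C.supp ⊆ X → D ≠ C := by
    intro X hX hne
    obtain ⟨v, w, hv, hw, hadj⟩ := hT.exists_adj_outside hX hne
    refine ⟨T.primalityGraph.connectedComponentMk v, fun h1 => ?_, ?_⟩
    · obtain ⟨u, hu⟩ := Set.ncard_eq_one.1 h1
      have e1 : v ∈ ({u} : Set V) := hu ▸ rfl
      have e2 : w ∈ ({u} : Set V) := hu ▸ (ConnectedComponent.sound hadj.symm.reachable)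
      exact hadj.ne (e1.trans e2.symm)
    · rintro C hC rfl
      exact hv (hC rfl)
  have hsome : ∃ C : T.primalityGraph.ConnectedComponent, C.order ≠ 1 := by
    obtain ⟨⟨a, -, -⟩, -⟩ := hT.1
    obtain ⟨u, -, v, -, -, -, -, hE⟩ := hT.1.exists_edge (Set.mem_univ a)
    obtain ⟨D, hD, -⟩ := outside _ (primeOn_of_edge hE) (by
      intro h
      have h1 := Set.ncard_univ V
      rw [← h] at h1
      have h2 := Set.ncard_insert_le a {u, v}
      have h3 := Set.ncard_insert_le u {v}
      rw [Set.ncard_singleton] at h3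
      omega)
    exact ⟨D, hD⟩
  have hsupp : ∀ C : T.primalityGraph.ConnectedComponent,
      {v | ∃ i < C.order, v = φ.seq C i} = C.supp := fun C =>
    Set.ext fun v => ((φ.isPathEnum C).mem_supp v).symm
  refine ⟨hsome, fun C hC hne => ?_, fun C hC h2 => ?_⟩
  · by_cases h1 : C.order = 1
    · obtain ⟨D, hD⟩ := hsome
      exact ⟨D, by rintro rfl; exact hD h1, hD⟩
    · have hp := (hT.isStrand (φ.isPathEnum C)).primeOn_of_odd hT.1 hC (by
        obtain ⟨k, hk⟩ := hC; omega)
      rw [hsupp] at hp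
      obtain ⟨v, -, hv⟩ := hne
      obtain ⟨D, hD, hDC⟩ := outside _ hp fun h => hv (h ▸ trivial)
      exact ⟨D, hDC C subset_rfl, hD⟩
  · have hs := hT.isStrand (φ.isPathEnum C)
    have hpos : 0 < C.order := (Set.ncard_pos (Set.toFinite _)).2 C.nonempty_supp
    have hge : 2 ≤ C.order := by obtain ⟨k, hk⟩ := hC; omega
    -- An even component is only prime together with one extra vertex `x`, hence the requirement
    -- that `C` miss two vertices.
    obtain ⟨x, hx, hE⟩ := hs.edges_of_even hT.1 hC hge
    have hp := hs.primeOn_of_even hC hge hx hE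
    rw [hsupp] at hp
    obtain ⟨D, hD, hDC⟩ := outside _ hp fun h => by
      have hsub : Set.univ \ C.supp ⊆ {x} := fun v hv =>
        (h ▸ Set.mem_univ v : v ∈ insert x C.supp).resolve_right hv.2
      have := Set.ncard_le_ncard hsub
      rw [Set.ncard_singleton] at this
      omega
    exact ⟨D, hDC C (Set.subset_insert _ _), hD⟩

end Critical
end TripleSystem

/-- The closed strand enumerates all vertices bijectively, and `edge_iff` matches its edges with the
3-cycles of `T_n`. -/
lemma Hypergraph.isCircular_of_isLoopStrand {α : Type*} {H : Hypergraph α}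
    {hunif : H.IsUniform 3} (hV : (H.triples hunif).PrimeOn Set.univ)
    (hcard : 5 ≤ H.vertexSet.ncard) {c : ℕ → H.vertexSet} {n : ℕ}
    (h : (H.triples hunif).IsLoopStrand c n) : H.IsCircular := by
  have hbij : Function.Bijective (fun i : Fin n => c i) :=
    ⟨fun i j e => Fin.ext (h.inj i i.2 j j.2 e), fun v => by
      obtain ⟨i, hi, e⟩ := h.surj hV v
      exact ⟨⟨i, hi⟩, e.symm⟩⟩
  obtain rfl : n = H.vertexSet.ncard := by
    rw [← Nat.card_coe_set_eq, ← Nat.card_eq_of_bijective _ hbij, Nat.card_fin]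
  set g := Equiv.ofBijective _ hbij with hg
  refine ⟨h.odd hV, g.symm.trans (Equiv.Set.univ _).symm, fun e => ?_⟩
  have himg : Subtype.val '' ((g.symm.trans (Equiv.Set.univ _).symm) '' e) = g.symm '' e := by
    rw [Set.image_image]; rfl
  suffices hs : Subtype.val '' e ∈ H.edgeSet ↔ g.symm '' e ∈ (tournamentT _).cThree.edgeSet from
    hs.trans (iff_of_eq (congrArg (· ∈ (tournamentT _).cThree.edgeSet) himg.symm))
  have hgs : ∀ i (hi : i < H.vertexSet.ncard), g.symm (c i) = ⟨i, hi⟩ := fun i hi =>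
    g.symm_apply_eq.2 rfl
  rw [mem_cThree_tournamentT_iff]
  constructor
  · intro he
    obtain ⟨a, b, d, -, -, -, heq, hE⟩ := exists_of_mem_edgeSet hunif he
    obtain rfl : e = {a, b, d} := by
      apply Set.image_injective.2 Subtype.val_injective
      rw [heq, Set.image_insert_eq, Set.image_pair]
    obtain ⟨i, hi, rfl⟩ := h.surj hV a
    obtain ⟨j, hj, rfl⟩ := h.surj hV b
    obtain ⟨k, hk, rfl⟩ := h.surj hV d
    obtain ⟨p, q, r, hpq, hqr, hr, hE', hset⟩ := exists_sorted hi hj hk hE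
    obtain ⟨h1, h2⟩ := (h.edge_iff hV hcard hpq hqr hr).1 hE'
    refine ⟨⟨p, by omega⟩, ⟨q, by omega⟩, ⟨r, hr⟩, hpq, hqr, h1, h2, ?_⟩
    rw [hset, Set.image_insert_eq, Set.image_pair, hgs, hgs, hgs]
  · rintro ⟨i, j, k, hij, hjk, h1, h2, heq⟩
    have he : e = g '' {i, j, k} := by rw [← heq, Equiv.image_symm_image]
    have hE := (h.edge_iff hV hcard hij hjk k.2).2 ⟨h1, h2⟩
    rw [he, Set.image_insert_eq, Set.image_pair, Set.image_insert_eq, Set.image_pair]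
    exact hE

theorem mainTheorem1 {α : Type*} (H : Hypergraph α)
    (hfin : H.vertexSet.Finite)
    (hunif : H.IsUniform 3)
    (hcrit : H.IsCritical)
    (hcard : 5 ≤ H.vertexSet.ncard)
    (hcirc : ¬ H.IsCircular) :
    ∃ Γ : SimpleGraph H.vertexSet,
      Γ = H.primalityGraph ∧
      Γ.ComponentsArePaths ∧
      Γ.IsNondegenerate ∧
      ∃ ℍ : Hypergraph Γ.ConnectedComponent,
        ℍ.vertexSet = Set.univ ∧
        ℍ.IsTwoThree ∧
        Γ.ParityConditions ℍ ∧
        ∀ φ : Γ.PathLabelling,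
          H = (Γ.bullet ℍ φ).image (Subtype.val : H.vertexSet → α) := by
  have hVfin : Finite H.vertexSet := hfin
  have hT := hcrit.triples (hunif := hunif) hfin
  have hpath : (H.triples hunif).primalityGraph.ComponentsArePaths := by
    intro C
    obtain ⟨c, n, hc⟩ := hT.exists_isPathEnum
      (fun c n h => hcirc (Hypergraph.isCircular_of_isLoopStrand hT.1 hcard h)) C
    exact hc.nonempty_iso
  -- Nondegeneracy and the parity conditions do not mention a labelling, so any one serves to prove
  -- them.
  let φ₀ : (H.triples hunif).primalityGraph.PathLabelling := fun C => (hpath C).some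
  refine ⟨(H.triples hunif).primalityGraph, (Hypergraph.primalityGraph_eq hfin).symm, hpath,
    hT.isNondegenerate φ₀ (by rw [Nat.card_coe_set_eq]; omega),
    (H.triples hunif).componentHypergraph, rfl, fun ε hε => hε.1, hT.parityConditions φ₀,
    fun φ => ?_⟩
  have hV : H.vertexSet =
      (((H.triples hunif).primalityGraph.bullet (H.triples hunif).componentHypergraph φ).image
        (Subtype.val : H.vertexSet → α)).vertexSet :=
    (Set.image_univ.trans Subtype.range_coe).symm
  have hE : H.edgeSet =
      (((H.triples hunif).primalityGraph.bullet (H.triples hunif).componentHypergraph φ).image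
        (Subtype.val : H.vertexSet → α)).edgeSet := by
    ext e
    constructor
    · intro he
      obtain ⟨a, b, d, -, -, -, rfl, hE⟩ := Hypergraph.exists_of_mem_edgeSet hunif he
      exact ⟨{a, b, d}, (hT.mem_bullet_iff φ).2 ⟨a, b, d, hE, rfl⟩, by
        rw [Set.image_insert_eq, Set.image_pair]⟩
    · rintro ⟨e', he', rfl⟩
      obtain ⟨a, b, d, hE, rfl⟩ := (hT.mem_bullet_iff φ).1 he'
      rw [Set.image_insert_eq, Set.image_pair]
      exact hE
  exact Hypergraph.ext hV hE
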